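/- Let $(M,g)$ be a compact connected Riemannian manifold (smooth, Hausdorff, without boundary) of dimension $n\ge 3$, and let $\sigma$ be a smooth generalized distribution on $M$: a choice of a linear subspace $\sigma(x)\subset T_xM$ for each $x\in M$ for which there is a set of $C^\infty$ vector fields, defined on open subsets of $M$, whose values at $x$ span $\sigma(x)$ for every $x$. Put $d(x)=\dim\sigma(x)$. Let $M_r$ be the open dense set of regular points (those near which $d$ is constant) and, for $1\le q\le n$, let $M_r^q=\{x\in M_r : d(x)=q\}$. On $M_r$ put $\mathcal V=\sigma$, $\mathcal H=\sigma^{\perp}$, let $P$ be the $(1,1)$-tensor field equal to $1$ on $\mathcal V$ and $-1$ on $\mathcal H$, let $\nabla$ be the Levi-Civita connection, and let $$\xi_XY=-\tfrac12\,P(\nabla_XP)Y$$ be the intrinsic torsion of $\sigma$. The total bending of $\sigma$ is $B(\sigma)=\frac14\int_{M_r}\|\xi\|^2\,dv_M\in[0,\infty]$, where $\|\xi\|^2=\sum_{k,m}\|\xi_{E_k}E_m\|^2$ for an orthonormal basis $(E_k)$ of the tangent space. For $\mathcal W\in\{\mathcal V,\mathcal H\}$, with orthonormal bases $(E_a)$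 of $\mathcal W$ and $(E_j)$ of $\mathcal W^\perp$, put $\xi_{ab}^j=g(\xi_{E_a}E_b,E_j)$ and $$\mu_{\mathcal W}=\sum_j\sum_{a<b}\bigl(\xi_{aa}^j\xi_{bb}^j-\xi_{ab}^j\xi_{ba}^j\bigr),\qquad h_{\mathcal W}(u,v)=\tfrac12(\xi_uv+\xi_vu)\ \ (u,v\in\mathcal W),\qquad H_{\mathcal W}=\sum_a h_{\mathcal W}(E_a,E_a).$$ On $M_r^q$, the distribution $\mathcal W$ is called geodesic if $h_{\mathcal W}=0$, umbilical if $h_{\mathcal W}(u,v)=\frac{g(u,v)}{\dim\mathcal W}H_{\mathcal W}$ for all $u,v\in\mathcal W$, and integrable if the Lie bracket of any two smooth vector fields defined on an open subset of $M_r^q$ and belonging to $\mathcal W$ again belongs to $\mathcal W$. Then $$B(\sigma)\ \ge\ \sum_{q=1}^{n}\int_{M_r^q}\Bigl(\frac{\mu_{\mathcal V}}{q-1}+\frac{\mu_{\mathcal H}}{n-q-1}\Bigr)\,dv_M, \qquad (*)$$ where a quotient with zero denominator is read as $0$ and the integral of a function is the integral of its positive part minus that of its negative part (any value may be assigned to $\infty-\infty$).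 If $B(\sigma)<\infty$, all integrands on the right are integrable. Consider the condition that for every $q\in\{1,\dots,n\}$, on $M_r^q$, 1. $\mathcal V$ is geodesic if $q=1$, umbilical if $q=2$, and umbilical and integrable if $3\le q\le n-1$; and 2. $\mathcal H$ is geodesic if $n-q=1$, umbilical if $n-q=2$, and umbilical and integrable if $n-q\ge 3$. If this condition holds, then equality holds in $(*)$ (both sides may be $\infty$). Conversely, if $B(\sigma)<\infty$ and equality holds in $(*)$, then this condition holds. -/

import Mathlib

open Set Filter MeasureTheory Bundle
open scoped Manifold ContDiff Topology ENNReal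

noncomputable section

namespace GenDist

/-- The vectors tangent at `x` to an `n`-dimensional manifold `M`. -/
abbrev Tan (n : ℕ) {M : Type*} [TopologicalSpace M] [ChartedSpace (EuclideanSpace ℝ (Fin n)) M]
    (x : M) : Type := TangentSpace (𝓡 n) x

variable {n : ℕ} {M : Type*} [TopologicalSpace M] [ChartedSpace (EuclideanSpace ℝ (Fin n)) M]
  [IsManifold (𝓡 n) ∞ M]

instance instFiniteDimensionalTan (x : M) : FiniteDimensional ℝ (Tan n x) :=
  inferInstanceAs (FiniteDimensional ℝ (EuclideanSpace ℝ (Fin n)))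

/-- The vector field `X` is `C^∞` on the set `U`. -/
def SmoothFieldOn (X : ∀ x : M, Tan n x) (U : Set M) : Prop :=
  ContMDiffOn (𝓡 n) ((𝓡 n).prod 𝓘(ℝ, EuclideanSpace ℝ (Fin n))) ∞
    (fun x => (⟨x, X x⟩ : TangentBundle (𝓡 n) M)) U

/-- A generalized distribution `σ` is smooth if it is spanned by a set `D` of `C^∞` vector fields
defined on open subsets of `M`: a pair `(U, X) ∈ D` is a field `X` with domain `U`, and `σ x` is
the linear hull of the values at `x` of the members of `D` whose domain contains `x`. -/
def IsSmooth (σ : ∀ x : M, Submodule ℝ (Tan n x)) : Prop :=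
  ∃ D : Set (Set M × (∀ x : M, Tan n x)),
    (∀ p ∈ D, IsOpen p.1 ∧ SmoothFieldOn p.2 p.1) ∧
    ∀ x, σ x = Submodule.span ℝ {v | ∃ p ∈ D, x ∈ p.1 ∧ p.2 x = v}

/-- The dimension function `d(x) = dim σ(x)`. -/
def dim (σ : ∀ x : M, Submodule ℝ (Tan n x)) (x : M) : ℕ := Module.finrank ℝ (σ x)

/-- The set `M_r` of regular points: `d` is constant on a neighbourhood of the point. -/
def regularSet (σ : ∀ x : M, Submodule ℝ (Tan n x)) : Set M :=
  {x | ∀ᶠ y in 𝓝 x, dim σ y = dim σ x}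

/-- The set of the regular points at which `d` takes the value `q`. -/
def stratum (σ : ∀ x : M, Submodule ℝ (Tan n x)) (q : ℕ) : Set M :=
  {x ∈ regularSet σ | dim σ x = q}

/-- `W` is integrable on the open set `S`, in the sense of Frobenius: the Lie bracket of two local
vector fields that belong to `W` belongs to `W`. -/
def IsIntegrableOn (W : ∀ x : M, Submodule ℝ (Tan n x)) (S : Set M) : Prop :=
  ∀ (U : Set M) (X Y : ∀ x : M, Tan n x), IsOpen U → U ⊆ S →
    SmoothFieldOn X U → SmoothFieldOn Y U → (∀ x ∈ U, X x ∈ W x) → (∀ x ∈ U, Y x ∈ W x) →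
    ∀ x ∈ U, VectorField.mlieBracket (𝓡 n) X Y x ∈ W x

variable [RiemannianBundle (fun x : M => TangentSpace (𝓡 n) x)]

/-! ### The Riemannian volume measure -/

/-- The coordinate vector `∂/∂y_i` of the chart `e` at the point with coordinates `y`. -/
def coordVector (e : OpenPartialHomeomorph M (EuclideanSpace ℝ (Fin n)))
    (y : EuclideanSpace ℝ (Fin n)) (i : Fin n) : Tan n (e.symm y) :=
  mfderiv (𝓡 n) (𝓡 n) e.symm y (EuclideanSpace.single i (1 : ℝ))

/-- The matrix `(g_ij)` of the metric in the chart `e`. -/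
def metricMatrix (e : OpenPartialHomeomorph M (EuclideanSpace ℝ (Fin n)))
    (y : EuclideanSpace ℝ (Fin n)) : Matrix (Fin n) (Fin n) ℝ :=
  Matrix.of fun i j => inner ℝ (coordVector e y i) (coordVector e y j)

/-- The measure `√det(g_ij) dy` of the chart `e`, carried over to the domain of `e`, and zero
outside of that domain. -/
def chartVolume [MeasurableSpace M] (e : OpenPartialHomeomorph M (EuclideanSpace ℝ (Fin n))) :
    Measure M :=
  (((volume : Measure (EuclideanSpace ℝ (Fin n))).restrict e.target).withDensity
    (fun y => ENNReal.ofReal (Real.sqrt (metricMatrix e y).det))).map e.symm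

variable (n M) in
/-- The Riemannian volume measure `dv_M`: the least measure that dominates `√det(g_ij) dy` in each
chart. As these chart measures agree on overlaps, it coincides with them on every chart domain. -/
def riemVolume [MeasurableSpace M] : Measure M :=
  ⨆ e ∈ atlas (EuclideanSpace ℝ (Fin n)) M, chartVolume e

/-! ### The Levi-Civita connection -/

/-- The derivative at `x`, in the direction `v`, of the function `g(Y, Z)`. -/
def dMetric (Y Z : ∀ x : M, Tan n x) (x : M) (v : Tan n x) : ℝ :=
  mvfderiv (𝓡 n) (fun y => (inner ℝ (Y y) (Z y) : ℝ)) x v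

/-- Half of the right-hand side of the Koszul formula, i.e. `g(∇_X Y, Z)` at `x`. -/
def koszul (X Y Z : ∀ x : M, Tan n x) (x : M) : ℝ :=
  (1 / 2 : ℝ) * (dMetric Y Z x (X x) + dMetric X Z x (Y x) - dMetric X Y x (Z x)
    + inner ℝ (VectorField.mlieBracket (𝓡 n) X Y x) (Z x)
    - inner ℝ (VectorField.mlieBracket (𝓡 n) X Z x) (Y x)
    - inner ℝ (VectorField.mlieBracket (𝓡 n) Y Z x) (X x))

/-- A vector field that extends the tangent vector `v` and is smooth near its base point. -/
def ext {x : M} (v : Tan n x) : ∀ y : M, Tan n y :=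
  FiberBundle.extend (EuclideanSpace ℝ (Fin n)) (E := fun y : M => TangentSpace (𝓡 n) y) v

/-- The Levi-Civita connection: `nabla Y x u` is the vector `∇_u Y` of `T_x M` whose inner
products with the vectors of an orthonormal basis are given by the Koszul formula. -/
def nabla (Y : ∀ x : M, Tan n x) (x : M) (u : Tan n x) : Tan n x :=
  ∑ k, koszul (ext u) Y (ext (stdOrthonormalBasis ℝ (Tan n x) k)) x •
    stdOrthonormalBasis ℝ (Tan n x) k

/-! ### The intrinsic torsion -/

/-- The almost-product structure `P` of `σ`: it is `1` on `σ` and `-1` on the orthogonal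
complement of `σ`. -/
def almostProduct (σ : ∀ x : M, Submodule ℝ (Tan n x)) (x : M) (v : Tan n x) : Tan n x :=
  (2 : ℝ) • (σ x).starProjection v - v

/-- The intrinsic torsion `ξ_u v = -½ P (∇_u P) v`, where `(∇_u P) V = ∇_u (P V) - P (∇_u V)`. -/
def torsion (σ : ∀ x : M, Submodule ℝ (Tan n x)) (x : M) (u v : Tan n x) : Tan n x :=
  -((1 / 2 : ℝ) • almostProduct σ x
    (nabla (fun y => almostProduct σ y (ext v y)) x u - almostProduct σ x (nabla (ext v) x u)))

/-- `‖ξ‖²` at the point `x`. -/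
def torsionNormSq (σ : ∀ x : M, Submodule ℝ (Tan n x)) (x : M) : ℝ :=
  ∑ k, ∑ m, ‖torsion σ x (stdOrthonormalBasis ℝ (Tan n x) k)
    (stdOrthonormalBasis ℝ (Tan n x) m)‖ ^ 2

/-- The total bending `B(σ) = ¼ ∫ ‖ξ‖² dv_M`, a number of `[0, ∞]`. -/
def totalBending [MeasurableSpace M] (σ : ∀ x : M, Submodule ℝ (Tan n x)) : ℝ≥0∞ :=
  (1 / 4) * ∫⁻ x in regularSet σ, ENNReal.ofReal (torsionNormSq σ x) ∂(riemVolume n M)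

/-! ### Second fundamental form, mean curvatures

Here `W` is one of the two distributions `σ`, `σ^⊥`, and `ξ` is the intrinsic torsion. -/

/-- The orthogonal distribution. -/
def orth (σ : ∀ x : M, Submodule ℝ (Tan n x)) : ∀ x : M, Submodule ℝ (Tan n x) :=
  fun x => (σ x)ᗮ

/-- The second fundamental form `h(u, v) = ½ (ξ_u v + ξ_v u)`; it is used for `u`, `v` in `σ x`
and for `u`, `v` in the orthogonal complement of `σ x`. -/
def secondForm (σ : ∀ x : M, Submodule ℝ (Tan n x)) (x : M) (u v : Tan n x) : Tan n x :=
  (1 / 2 : ℝ) • (torsion σ x u v + torsion σ x v u)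

/-- The mean curvature vector of `W`, the trace over `W` of the second fundamental form. -/
def meanCurvature (σ W : ∀ x : M, Submodule ℝ (Tan n x)) (x : M) : Tan n x :=
  ∑ a, secondForm σ x (stdOrthonormalBasis ℝ (W x) a : Tan n x) (stdOrthonormalBasis ℝ (W x) a)

/-- The component `ξ_{ab}^j = g(ξ_{E_a} E_b, E_j)`, where `(E_a)` and `(E_j)` are orthonormal bases
of `W x` and of its orthogonal complement. -/
def torsionComp (σ W : ∀ x : M, Submodule ℝ (Tan n x)) (x : M)
    (a b : Fin (Module.finrank ℝ (W x))) (j : Fin (Module.finrank ℝ (orth W x))) : ℝ :=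
  inner ℝ (torsion σ x (stdOrthonormalBasis ℝ (W x) a : Tan n x)
    (stdOrthonormalBasis ℝ (W x) b : Tan n x)) (stdOrthonormalBasis ℝ (orth W x) j : Tan n x)

/-- The second mean curvature `μ_W = ∑_j ∑_{a<b} (ξ_{aa}^j ξ_{bb}^j - ξ_{ab}^j ξ_{ba}^j)`. -/
def secondMeanCurvature (σ W : ∀ x : M, Submodule ℝ (Tan n x)) (x : M) : ℝ :=
  ∑ j, ∑ a, ∑ b ∈ Finset.Ioi a,
    (torsionComp σ W x a a j * torsionComp σ W x b b j
      - torsionComp σ W x a b j * torsionComp σ W x b a j)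

/-- `W` is geodesic on `S`: its second fundamental form vanishes. -/
def IsGeodesicOn (σ W : ∀ x : M, Submodule ℝ (Tan n x)) (S : Set M) : Prop :=
  ∀ x ∈ S, ∀ u ∈ W x, ∀ v ∈ W x, secondForm σ x u v = 0

/-- `W` is umbilical on `S`: `h = (g / dim W) H` on `W`. -/
def IsUmbilicalOn (σ W : ∀ x : M, Submodule ℝ (Tan n x)) (S : Set M) : Prop :=
  ∀ x ∈ S, ∀ u ∈ W x, ∀ v ∈ W x,
    secondForm σ x u v = ((inner ℝ u v : ℝ) / (dim W x : ℝ)) • meanCurvature σ W x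

/-- The integrand `μ_V / (q - 1) + μ_H / (n - q - 1)` on the stratum of dimension `q`. A quotient
with zero denominator counts as zero. -/
def lowerIntegrand (σ : ∀ x : M, Submodule ℝ (Tan n x)) (q : ℕ) (x : M) : ℝ :=
  secondMeanCurvature σ σ x / ((q : ℝ) - 1)
    + secondMeanCurvature σ (orth σ) x / ((n : ℝ) - (q : ℝ) - 1)

/-- The integral of `f` over `S` as an extended real number: the integral of the positive part minus
the integral of the negative part. -/
def extIntegral {α : Type*} [MeasurableSpace α] (μ : Measure α) (S : Set α) (f : α → ℝ) : EReal :=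
  ((∫⁻ x in S, ENNReal.ofReal (f x) ∂μ : ℝ≥0∞) : EReal)
    - ((∫⁻ x in S, ENNReal.ofReal (-f x) ∂μ : ℝ≥0∞) : EReal)

/-- The right-hand side of the inequality. -/
def lowerBound [MeasurableSpace M] (σ : ∀ x : M, Submodule ℝ (Tan n x)) : EReal :=
  ∑ q ∈ Finset.Icc 1 n, extIntegral (riemVolume n M) (stratum σ q) (lowerIntegrand σ q)

/-- The conditions for equality. -/
def EqualityConditions (σ : ∀ x : M, Submodule ℝ (Tan n x)) : Prop :=
  ∀ q ∈ Finset.Icc 1 n,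
    ((q = 1 → IsGeodesicOn σ σ (stratum σ q)) ∧
      (q = 2 → IsUmbilicalOn σ σ (stratum σ q)) ∧
      (3 ≤ q ∧ q ≤ n - 1 →
        IsUmbilicalOn σ σ (stratum σ q) ∧ IsIntegrableOn σ (stratum σ q))) ∧
    ((q + 1 = n → IsGeodesicOn σ (orth σ) (stratum σ q)) ∧
      (q + 2 = n → IsUmbilicalOn σ (orth σ) (stratum σ q)) ∧
      (q + 3 ≤ n →
        IsUmbilicalOn σ (orth σ) (stratum σ q) ∧ IsIntegrableOn (orth σ) (stratum σ q)))

end GenDist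

end

open GenDist

/-!
The inequality holds pointwise before integration. Let `ξ` be the intrinsic torsion at a regular
point, and write `ξ_ab^j` for its components. Each `ξ_u` is skew-symmetric and anticommutes with
`P`, so it exchanges the distribution with its orthogonal complement, and the mixed components of
`ξ` repeat the pure ones: `¼ ‖ξ‖²` is half the sum of the squares of the components `ξ_ab^j` with
`a`, `b` in `V`, plus the same for `H` (`torsionNormSq_eq`). For each normal index `j` the matrix `A
= (ξ_ab^j)` of size `p = dim W ≥ 2` satisfies `2 μ(A) ≤ (p - 1) |A|²`, where `μ(A)` is the sum of
the principal `2 × 2` minors, since the difference is a sum of squares (`sumMinors_defect`); for `p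
= 1` the quotient `μ(A) / (p - 1)` is read as zero and `0 ≤ |A|²` is used. Adding up over `j` gives
the inequality between the integrands (`lowerIntegrand_le`). The same bound for the opposite of the
lower integrand (`neg_lowerIntegrand_le`) makes it integrable if the total bending is finite.

The squares show when equality holds (`sumMinors_div_eq_iff`): `A = 0` for `p = 1`, the symmetric
part of `A` is scalar for `p ≥ 2`, and the skew part vanishes too for `p ≥ 3`. The condition on the
symmetric part says that `W` is geodesic or umbilical. The Levi-Civita connection being
torsion-free, the skew part `ξ_u v - ξ_v u` is the component normal to `W` of the Lie bracket of
fields of `W` (`inner_torsion_sub_swap`), so that it vanishes exactly if `W` is integrable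
(`isIntegrableOn_iff`). Hence the equality conditions mean that the integrands agree at every point
of the strata (`equalityConditions_iff`).

If the integrals agree and are finite, the integrands agree almost everywhere. They are continuous
on the open set of regular points: there are smooth orthonormal frames adapted to the distribution
(`exists_isAdaptedFrame`), and in such a frame the components of `ξ` are combinations of components
of Lie brackets (`continuousOn_koszul`). As nonempty open sets have positive volume
(`riemVolume_ne_zero_of_isOpen`), the integrands then agree everywhere.

All this rests on the tensoriality of the Koszul expression `g(∇_X Y, Z)` in `X` and `Z`, and of
`g(ξ_X Y, Z)` in all three fields (`inner_nabla`, `inner_torsion`). The latter holds at points where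
`P` preserves the differentiability of vector fields; this is the hypothesis `hP` of many lemmas
below, which regular points satisfy (`DiffFieldAt.reflField`).
-/

set_option linter.unusedSectionVars false

namespace GenDist

/-! ### An inequality for the principal `2 × 2` minors of a matrix -/

theorem sum_sum_Ioi_of_symm {p : ℕ} (F : Fin p → Fin p → ℝ) (hs : ∀ a b, F a b = F b a)
    (h0 : ∀ a, F a a = 0) : ∑ a, ∑ b ∈ Finset.Ioi a, F a b = (1 / 2) * ∑ a, ∑ b, F a b := by
  have key : ∑ a, ∑ b ∈ Finset.Iio a, F a b = ∑ a, ∑ b ∈ Finset.Ioi a, F a b := by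
    rw [Finset.sum_comm' (t' := Finset.univ) (s' := fun b => Finset.Ioi b) (by simp)]
    exact Finset.sum_congr rfl fun a _ => Finset.sum_congr rfl fun b _ => hs _ _
  have split : ∀ a, ∑ b, F a b = ∑ b ∈ Finset.Iio a, F a b + ∑ b ∈ Finset.Ioi a, F a b := by
    intro a
    have hd : Disjoint (Finset.Iio a) (Finset.Ioi a) := by
      rw [Finset.disjoint_left]
      intro b hb hb'
      simp only [Finset.mem_Iio, Finset.mem_Ioi] at hb hb'
      exact lt_asymm hb hb'
    rw [← Finset.sum_union hd]
    symm
    apply Finset.sum_subset (Finset.subset_univ _)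
    intro b _ hb
    simp only [Finset.mem_union, Finset.mem_Iio, Finset.mem_Ioi, not_or, not_lt] at hb
    rw [le_antisymm hb.2 hb.1, h0]
  simp only [split, Finset.sum_add_distrib, key]
  ring

/-- The sum of the principal `2 × 2` minors of a square matrix. -/
noncomputable def sumMinors {p : ℕ} (A : Fin p → Fin p → ℝ) : ℝ :=
  ∑ a, ∑ b ∈ Finset.Ioi a, (A a a * A b b - A a b * A b a)

theorem sumMinors_eq {p : ℕ} (A : Fin p → Fin p → ℝ) :
    sumMinors A = (1 / 2) * ((∑ a, A a a) ^ 2 - ∑ a, ∑ b, A a b * A b a) := by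
  rw [sumMinors, sum_sum_Ioi_of_symm (fun a b => A a a * A b b - A a b * A b a)
    (fun a b => by ring) (fun a => by ring)]
  simp only [Finset.sum_sub_distrib, sq, Finset.sum_mul_sum]

/-- The difference between the two sides of the inequality `2 μ(A) ≤ (p - 1) |A|²` as a sum
of squares. -/
theorem sumMinors_defect {p : ℕ} (A : Fin p → Fin p → ℝ) :
    2 * (((p : ℝ) - 1) * (∑ a, ∑ b, A a b ^ 2) - 2 * sumMinors A) =
      ∑ a, ∑ b, ((A a a - A b b) ^ 2 +
        if a = b then 0 else (A a b + A b a) ^ 2 + 2 * ((p : ℝ) - 2) * A a b ^ 2) := by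
  have hswap : ∑ a, ∑ b, A b a ^ 2 = ∑ a, ∑ b, A a b ^ 2 := Finset.sum_comm
  have hterm : ∀ a b, ((A a a - A b b) ^ 2 +
        if a = b then 0 else (A a b + A b a) ^ 2 + 2 * ((p : ℝ) - 2) * A a b ^ 2) =
      A a a ^ 2 + A b b ^ 2 - 2 * (A a a * A b b) + (2 * (p : ℝ) - 3) * A a b ^ 2 + A b a ^ 2
        + 2 * (A a b * A b a) - if a = b then 2 * (p : ℝ) * A a a ^ 2 else 0 := by
    intro a b
    split_ifs with h
    · subst h; ring
    · ring
  simp only [hterm, Finset.sum_add_distrib, Finset.sum_sub_distrib, ← Finset.mul_sum,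
    Finset.sum_const, Finset.card_univ, Fintype.card_fin, Finset.sum_ite_eq, Finset.mem_univ,
    if_true, hswap, nsmul_eq_mul]
  rw [sumMinors_eq, sq (∑ a, A a a), Finset.sum_mul_sum]
  simp only [← Finset.mul_sum]
  ring

theorem sumMinors_defect_term_nonneg {p : ℕ} (hp : 2 ≤ p) (A : Fin p → Fin p → ℝ) (a b : Fin p) :
    0 ≤ ((A a a - A b b) ^ 2 +
      if a = b then 0 else (A a b + A b a) ^ 2 + 2 * ((p : ℝ) - 2) * A a b ^ 2) := by
  have : (0 : ℝ) ≤ (p : ℝ) - 2 := by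
    have : (2 : ℝ) ≤ p := by exact_mod_cast hp
    linarith
  split_ifs <;> positivity

/-- For `p ≤ 1` there are no minors, and the quotient is zero. -/
theorem sumMinors_div_le {p : ℕ} (A : Fin p → Fin p → ℝ) :
    sumMinors A / ((p : ℝ) - 1) ≤ (1 / 2) * ∑ a, ∑ b, A a b ^ 2 := by
  rcases Nat.lt_or_ge p 2 with hp | hp
  · interval_cases p
    · simp [sumMinors]
    · simp only [Nat.cast_one, sub_self, div_zero]; positivity
  · have hp' : (0 : ℝ) < (p : ℝ) - 1 := by
      have : (2 : ℝ) ≤ p := by exact_mod_cast hp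
      linarith
    rw [div_le_iff₀ hp']
    have h := sumMinors_defect A
    have h2 : 0 ≤ ∑ a, ∑ b, ((A a a - A b b) ^ 2 +
        if a = b then 0 else (A a b + A b a) ^ 2 + 2 * ((p : ℝ) - 2) * A a b ^ 2) :=
      Finset.sum_nonneg fun a _ => Finset.sum_nonneg fun b _ =>
        sumMinors_defect_term_nonneg hp A a b
    linarith

/-- The quotient is also bounded from below; this serves to bound its absolute value. -/
theorem neg_sumMinors_div_le {p : ℕ} (A : Fin p → Fin p → ℝ) :
    -(sumMinors A / ((p : ℝ) - 1)) ≤ (1 / 2) * ∑ a, ∑ b, A a b ^ 2 := by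
  rcases Nat.lt_or_ge p 2 with hp | hp
  · interval_cases p
    · simp [sumMinors]
    · simp only [Nat.cast_one, sub_self, div_zero, neg_zero]; positivity
  · have hp' : (1 : ℝ) ≤ (p : ℝ) - 1 := by
      have : (2 : ℝ) ≤ p := by exact_mod_cast hp
      linarith
    have hS : 0 ≤ ∑ a, ∑ b, A a b ^ 2 := by positivity
    rw [← neg_div, div_le_iff₀ (by linarith), sumMinors_eq]
    have h1 : ∑ a, ∑ b, A a b * A b a ≤ ∑ a, ∑ b, A a b ^ 2 := by
      have hswap : ∑ a, ∑ b, A b a ^ 2 = ∑ a, ∑ b, A a b ^ 2 := Finset.sum_comm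
      have : ∑ a, ∑ b, A a b * A b a ≤ ∑ a, ∑ b, ((1 / 2) * A a b ^ 2 + (1 / 2) * A b a ^ 2) :=
        Finset.sum_le_sum fun a _ => Finset.sum_le_sum fun b _ => by
          nlinarith [sq_nonneg (A a b - A b a)]
      simp only [Finset.sum_add_distrib, ← Finset.mul_sum, hswap] at this
      linarith
    nlinarith [sq_nonneg (∑ a, A a a)]

/-- The equality case for matrices: for `p = 1` the matrix is zero; for `p ≥ 2` its symmetric
part is scalar, and for `p ≥ 3` it is symmetric too. -/
theorem sumMinors_div_eq_iff {p : ℕ} (A : Fin p → Fin p → ℝ) :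
    sumMinors A / ((p : ℝ) - 1) = (1 / 2) * ∑ a, ∑ b, A a b ^ 2 ↔
      (p = 1 → ∀ a b, A a b = 0) ∧
      (2 ≤ p → ∀ a b, (1 / 2) * (A a b + A b a) = (if a = b then 1 else 0) / (p : ℝ) * ∑ c, A c c) ∧
      (3 ≤ p → ∀ a b, A a b = A b a) := by
  rcases Nat.lt_or_ge p 2 with hp | hp
  · interval_cases p
    · simp [sumMinors]
    · simp [Fin.forall_fin_one, eq_comm (a := (0 : ℝ))]
  have hp2 : (2 : ℝ) ≤ p := by exact_mod_cast hp
  have hp1 : (p : ℝ) - 1 ≠ 0 := by linarith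
  have h0 : (p : ℝ) ≠ 0 := by linarith
  have hdef := sumMinors_defect A
  have hiff : sumMinors A / ((p : ℝ) - 1) = (1 / 2) * ∑ a, ∑ b, A a b ^ 2 ↔
      ∑ a, ∑ b, ((A a a - A b b) ^ 2 +
        if a = b then 0 else (A a b + A b a) ^ 2 + 2 * ((p : ℝ) - 2) * A a b ^ 2) = 0 := by
    rw [← hdef, div_eq_iff hp1]
    constructor <;> intro h <;> linarith
  rw [hiff, Finset.sum_eq_zero_iff_of_nonneg (fun a _ => Finset.sum_nonneg fun b _ =>
    sumMinors_defect_term_nonneg hp A a b)]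
  simp only [Finset.mem_univ, true_imp_iff, Finset.sum_eq_zero_iff_of_nonneg (fun b _ =>
    sumMinors_defect_term_nonneg hp A _ b)]
  constructor
  · intro h
    have hdiag : ∀ a b, A a a = A b b := by
      intro a b
      have h1 := h a b
      by_cases hab : a = b
      · rw [hab]
      · rw [if_neg hab] at h1
        have : 0 ≤ 2 * ((p : ℝ) - 2) * A a b ^ 2 := mul_nonneg (by linarith) (sq_nonneg _)
        nlinarith [sq_nonneg (A a a - A b b), sq_nonneg (A a b + A b a)]
    refine ⟨fun h => by omega, fun _ a b => ?_, fun h3 a b => ?_⟩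
    · split_ifs with hab
      · subst hab
        rw [Finset.sum_congr rfl fun c _ => hdiag c a]
        simp only [Finset.sum_const, Finset.card_univ, Fintype.card_fin, nsmul_eq_mul]
        field_simp
        ring
      · have h1 := h a b
        rw [if_neg hab] at h1
        have : 0 ≤ 2 * ((p : ℝ) - 2) * A a b ^ 2 := mul_nonneg (by linarith) (sq_nonneg _)
        have : A a b + A b a = 0 := by
          nlinarith [sq_nonneg (A a a - A b b), sq_nonneg (A a b + A b a)]
        rw [this]; ring
    · by_cases hab : a = b
      · rw [hab]
      have h3' : (3 : ℝ) ≤ p := by exact_mod_cast h3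
      have key : ∀ a b, a ≠ b → A a b = 0 := by
        intro a b hab
        have h1 := h a b
        rw [if_neg hab] at h1
        nlinarith [sq_nonneg (A a a - A b b), sq_nonneg (A a b + A b a), sq_nonneg (A a b)]
      rw [key a b hab, key b a (Ne.symm hab)]
  · rintro ⟨-, h2, h3⟩ a b
    have h2 := h2 hp
    have hdiag : ∀ a, A a a = (1 / (p : ℝ)) * ∑ c, A c c := fun a => by
      have := h2 a a
      rw [if_pos rfl] at this
      linarith
    have e1 : A a a - A b b = 0 := by rw [hdiag a, hdiag b, sub_self]
    rw [e1]
    split_ifs with hab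
    · simp
    · have h4 := h2 a b
      rw [if_neg hab] at h4
      have h5 : A a b + A b a = 0 := by simpa using h4
      rw [h5]
      rcases Nat.lt_or_ge p 3 with hp3 | hp3
      · have : p = 2 := by omega
        subst this; simp
      · have := h3 hp3 a b
        have : A a b = 0 := by linarith
        rw [this]; simp

/-! ### Traces of bilinear maps -/

section LinearAlgebra

variable {E F : Type*} [NormedAddCommGroup E] [InnerProductSpace ℝ E] [AddCommGroup F] [Module ℝ F]
  {ι κ : Type*} [Fintype ι] [Fintype κ]

/-- The trace of a bilinear map with respect to the inner product does not depend on the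
orthonormal basis. -/
theorem sum_bilin_orthonormalBasis (B : E →ₗ[ℝ] E →ₗ[ℝ] F) (b : OrthonormalBasis ι ℝ E)
    (b' : OrthonormalBasis κ ℝ E) : ∑ i, B (b i) (b i) = ∑ k, B (b' k) (b' k) := by
  classical
  have h1 : ∀ i, B (b i) (b i) =
      ∑ k, ∑ l, ((inner ℝ (b' k) (b i) : ℝ) * inner ℝ (b i) (b' l)) • B (b' k) (b' l) := by
    intro i
    conv_lhs => rw [← b'.sum_repr' (b i)]
    simp only [map_sum, LinearMap.sum_apply, map_smul, LinearMap.smul_apply, smul_smul,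
      Finset.smul_sum, real_inner_comm (b i)]
    rw [Finset.sum_comm]
    refine Finset.sum_congr rfl fun k _ => Finset.sum_congr rfl fun l _ => ?_
    rw [mul_comm]
  simp only [h1]
  rw [Finset.sum_comm]
  refine Finset.sum_congr rfl fun k _ => ?_
  rw [Finset.sum_comm]
  simp only [← Finset.sum_smul, OrthonormalBasis.sum_inner_mul_inner]
  rw [Finset.sum_eq_single k]
  · simp
  · intro l _ hl
    rw [b'.orthonormal.2 (Ne.symm hl), zero_smul]
  · simp

variable {W : Type*} [NormedAddCommGroup W] [InnerProductSpace ℝ W]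

theorem sum_normSq_bilin_orthonormalBasis (h : W →ₗ[ℝ] W →ₗ[ℝ] E) (b : OrthonormalBasis ι ℝ W)
    (b' : OrthonormalBasis κ ℝ W) :
    ∑ i, ∑ j, ‖h (b i) (b j)‖ ^ 2 = ∑ i, ∑ j, ‖h (b' i) (b' j)‖ ^ 2 := by
  have step : ∀ u u', ∑ j, (inner ℝ (h u (b j)) (h u' (b j)) : ℝ) =
      ∑ j, (inner ℝ (h u (b' j)) (h u' (b' j)) : ℝ) := fun u u' => by
    exact sum_bilin_orthonormalBasis
      (LinearMap.mk₂ ℝ (fun w w' => (inner ℝ (h u w) (h u' w') : ℝ))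
        (by intros; simp [inner_add_left]) (by intros; simp [real_inner_smul_left])
        (by intros; simp [inner_add_right]) (by intros; simp [real_inner_smul_right])) b b'
  simp only [← real_inner_self_eq_norm_sq, step]
  exact sum_bilin_orthonormalBasis
      (LinearMap.mk₂ ℝ (fun w w' => ∑ j, (inner ℝ (h w (b' j)) (h w' (b' j)) : ℝ))
        (by intros; simp [inner_add_left, Finset.sum_add_distrib])
        (by intros; simp [real_inner_smul_left, Finset.mul_sum])
        (by intros; simp [inner_add_right, Finset.sum_add_distrib])
        (by intros; simp [real_inner_smul_right, Finset.mul_sum])) b b'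

theorem sum_inner_swap_bilin_orthonormalBasis (h : W →ₗ[ℝ] W →ₗ[ℝ] E)
    (b : OrthonormalBasis ι ℝ W) (b' : OrthonormalBasis κ ℝ W) :
    ∑ i, ∑ j, (inner ℝ (h (b i) (b j)) (h (b j) (b i)) : ℝ) =
      ∑ i, ∑ j, (inner ℝ (h (b' i) (b' j)) (h (b' j) (b' i)) : ℝ) := by
  have step : ∀ u u', ∑ j, (inner ℝ (h u (b j)) (h (b j) u') : ℝ) =
      ∑ j, (inner ℝ (h u (b' j)) (h (b' j) u') : ℝ) := fun u u' => by
    exact sum_bilin_orthonormalBasis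
      (LinearMap.mk₂ ℝ (fun w w' => (inner ℝ (h u w) (h w' u') : ℝ))
        (by intros; simp [inner_add_left]) (by intros; simp [real_inner_smul_left])
        (by intros; simp [inner_add_right]) (by intros; simp [real_inner_smul_right])) b b'
  simp only [step]
  exact sum_bilin_orthonormalBasis
      (LinearMap.mk₂ ℝ (fun w w' => ∑ j, (inner ℝ (h w (b' j)) (h (b' j) w') : ℝ))
        (by intros; simp [inner_add_left, Finset.sum_add_distrib])
        (by intros; simp [real_inner_smul_left, Finset.mul_sum])
        (by intros; simp [inner_add_right, Finset.sum_add_distrib])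
        (by intros; simp [real_inner_smul_right, Finset.mul_sum])) b b'

/-- The Parseval identity for two vectors of a subspace, in an orthonormal basis of the subspace. -/
theorem sum_inner_mul_inner_of_mem {K : Submodule ℝ E} (c : OrthonormalBasis ι ℝ K) {u v : E}
    (hu : u ∈ K) (hv : v ∈ K) :
    ∑ j, (inner ℝ u (c j : E) : ℝ) * inner ℝ v (c j : E) = inner ℝ u v := by
  have := c.sum_inner_mul_inner ⟨u, hu⟩ ⟨v, hv⟩
  simpa [real_inner_comm] using this

theorem eq_zero_of_inner_eq_zero_of_mem {K : Submodule ℝ E} (c : OrthonormalBasis ι ℝ K) {u : E}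
    (hu : u ∈ K) (h : ∀ j, (inner ℝ u (c j : E) : ℝ) = 0) : u = 0 := by
  have := sum_inner_mul_inner_of_mem c hu hu
  simpa [h, eq_comm (a := (0 : ℝ))] using this

end LinearAlgebra

/-! ### The Koszul expression and the Levi-Civita connection -/

section Connection

variable {n : ℕ} {M : Type*} [TopologicalSpace M] [ChartedSpace (EuclideanSpace ℝ (Fin n)) M]
  [IsManifold (𝓡 n) ∞ M] [RiemannianBundle (fun x : M => TangentSpace (𝓡 n) x)]
  [IsContMDiffRiemannianBundle (𝓡 n) ∞ (EuclideanSpace ℝ (Fin n))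
      (fun x : M => TangentSpace (𝓡 n) x)]

/-- The vector field `X` is differentiable at `x`. This is all that the algebra of the Koszul
expression requires at a point. -/
abbrev DiffFieldAt (X : ∀ x : M, Tan n x) (x : M) : Prop :=
  MDifferentiableAt (𝓡 n) ((𝓡 n).prod 𝓘(ℝ, EuclideanSpace ℝ (Fin n)))
    (fun x => (⟨x, X x⟩ : TangentBundle (𝓡 n) M)) x

variable {x : M} {X Y Z X' Y' Z' : ∀ x : M, Tan n x}

theorem diffFieldAt_ext (v : Tan n x) : DiffFieldAt (ext v) x :=
  FiberBundle.mdifferentiableAt_extend (𝓡 n) (EuclideanSpace ℝ (Fin n)) v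

@[simp] theorem ext_self (v : Tan n x) : ext v x = v :=
  FiberBundle.extend_apply_self _ v

theorem DiffFieldAt.inner_field (hY : DiffFieldAt Y x) (hZ : DiffFieldAt Z x) :
    MDifferentiableAt (𝓡 n) 𝓘(ℝ) (fun y => (inner ℝ (Y y) (Z y) : ℝ)) x := by
  have : IsContMDiffRiemannianBundle (𝓡 n) 1 (EuclideanSpace ℝ (Fin n))
      (fun x : M => TangentSpace (𝓡 n) x) :=
    IsContMDiffRiemannianBundle.of_le (n := ∞) (by exact_mod_cast le_top)
  exact MDifferentiableAt.inner_bundle (IB := 𝓡 n) (F := EuclideanSpace ℝ (Fin n))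
    (E := fun x : M => TangentSpace (𝓡 n) x) hY hZ

theorem dMetric_comm (Y Z : ∀ x : M, Tan n x) (x : M) (v : Tan n x) :
    dMetric Y Z x v = dMetric Z Y x v := by
  unfold dMetric
  simp only [real_inner_comm]

theorem dMetric_smul_left {f : M → ℝ} (hf : MDifferentiableAt (𝓡 n) 𝓘(ℝ) f x)
    (hY : DiffFieldAt Y x) (hZ : DiffFieldAt Z x) (v : Tan n x) :
    dMetric (f • Y) Z x v = f x * dMetric Y Z x v + mvfderiv (𝓡 n) f x v * inner ℝ (Y x) (Z x) := by
  have := mvfderiv_fun_mul hf (hY.inner_field hZ)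
  unfold dMetric
  simp only [Pi.smul_apply', real_inner_smul_left]
  rw [this]
  simp
  ring

theorem dMetric_add_left (hY : DiffFieldAt Y x) (hY' : DiffFieldAt Y' x) (hZ : DiffFieldAt Z x)
    (v : Tan n x) : dMetric (Y + Y') Z x v = dMetric Y Z x v + dMetric Y' Z x v := by
  have := mvfderiv_fun_add (hY.inner_field hZ) (hY'.inner_field hZ)
  unfold dMetric
  simp only [Pi.add_apply, inner_add_left]
  rw [this]
  simp

theorem dMetric_map_smul (Y Z : ∀ x : M, Tan n x) (x : M) (c : ℝ) (v : Tan n x) :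
    dMetric Y Z x (c • v) = c * dMetric Y Z x v := by
  unfold dMetric
  rw [map_smul, smul_eq_mul]

theorem dMetric_map_add (Y Z : ∀ x : M, Tan n x) (x : M) (v w : Tan n x) :
    dMetric Y Z x (v + w) = dMetric Y Z x v + dMetric Y Z x w := by
  unfold dMetric
  rw [map_add]

theorem koszul_smul_left {f : M → ℝ} (hf : MDifferentiableAt (𝓡 n) 𝓘(ℝ) f x)
    (hX : DiffFieldAt X x) (hY : DiffFieldAt Y x) (hZ : DiffFieldAt Z x) :
    koszul (f • X) Y Z x = f x * koszul X Y Z x := by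
  unfold koszul
  rw [dMetric_smul_left hf hX hZ, dMetric_smul_left hf hX hY,
    VectorField.mlieBracket_smul_left hf hX, VectorField.mlieBracket_smul_left hf hX]
  simp only [Pi.smul_apply', dMetric_map_smul, neg_smul, inner_add_left, inner_neg_left,
    real_inner_smul_left, real_inner_smul_right]
  ring

theorem koszul_add_left (hX : DiffFieldAt X x) (hX' : DiffFieldAt X' x) (hY : DiffFieldAt Y x)
    (hZ : DiffFieldAt Z x) :
    koszul (X + X') Y Z x = koszul X Y Z x + koszul X' Y Z x := by
  unfold koszul
  rw [dMetric_add_left hX hX' hZ, dMetric_add_left hX hX' hY,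
    VectorField.mlieBracket_add_left hX hX', VectorField.mlieBracket_add_left hX hX']
  simp only [Pi.add_apply, dMetric_map_add, inner_add_left, inner_add_right]
  ring

/-- The Levi-Civita connection is torsion-free, in Koszul form. -/
theorem koszul_sub_swap (X Y Z : ∀ x : M, Tan n x) (x : M) :
    koszul X Y Z x - koszul Y X Z x = inner ℝ (VectorField.mlieBracket (𝓡 n) X Y x) (Z x) := by
  unfold koszul
  rw [VectorField.mlieBracket_swap_apply (V := Y) (W := X), inner_neg_left, dMetric_comm Y X]
  ring

/-- The Levi-Civita connection preserves the metric, in Koszul form. -/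
theorem koszul_add_swap (X Y Z : ∀ x : M, Tan n x) (x : M) :
    koszul X Y Z x + koszul X Z Y x = dMetric Y Z x (X x) := by
  unfold koszul
  rw [VectorField.mlieBracket_swap_apply (V := Z) (W := Y), inner_neg_left, dMetric_comm Z Y]
  ring

theorem koszul_smul_right {f : M → ℝ} (hf : MDifferentiableAt (𝓡 n) 𝓘(ℝ) f x)
    (hX : DiffFieldAt X x) (hY : DiffFieldAt Y x) (hZ : DiffFieldAt Z x) :
    koszul X Y (f • Z) x = f x * koszul X Y Z x := by
  unfold koszul
  rw [dMetric_comm Y, dMetric_comm X, dMetric_smul_left hf hZ hX, dMetric_smul_left hf hZ hY,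
    VectorField.mlieBracket_smul_right hf hZ, VectorField.mlieBracket_smul_right hf hZ,
    dMetric_comm Y Z, dMetric_comm X Z]
  simp only [Pi.smul_apply', dMetric_map_smul, inner_add_left,
    real_inner_smul_left, real_inner_smul_right, real_inner_comm]
  ring

theorem koszul_add_right (hX : DiffFieldAt X x) (hY : DiffFieldAt Y x)
    (hZ : DiffFieldAt Z x) (hZ' : DiffFieldAt Z' x) :
    koszul X Y (Z + Z') x = koszul X Y Z x + koszul X Y Z' x := by
  unfold koszul
  rw [dMetric_comm Y, dMetric_comm X, dMetric_add_left hZ hZ' hX, dMetric_add_left hZ hZ' hY,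
    VectorField.mlieBracket_add_right hZ hZ', VectorField.mlieBracket_add_right hZ hZ',
    dMetric_comm Y Z, dMetric_comm X Z, dMetric_comm Y Z', dMetric_comm X Z']
  simp only [Pi.add_apply, dMetric_map_add, inner_add_left, inner_add_right]
  ring

/-- The Leibniz rule for the Levi-Civita connection, in Koszul form. -/
theorem koszul_smul_middle {f : M → ℝ} (hf : MDifferentiableAt (𝓡 n) 𝓘(ℝ) f x)
    (hX : DiffFieldAt X x) (hY : DiffFieldAt Y x) (hZ : DiffFieldAt Z x) :
    koszul X (f • Y) Z x =
      f x * koszul X Y Z x + mvfderiv (𝓡 n) f x (X x) * inner ℝ (Y x) (Z x) := by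
  have h1 := koszul_add_swap X (f • Y) Z x
  have h2 := koszul_add_swap X Y Z x
  rw [koszul_smul_right hf hX hZ hY, dMetric_smul_left hf hY hZ] at h1
  linear_combination h1 - f x * h2

theorem koszul_add_middle (hX : DiffFieldAt X x) (hY : DiffFieldAt Y x)
    (hY' : DiffFieldAt Y' x) (hZ : DiffFieldAt Z x) :
    koszul X (Y + Y') Z x = koszul X Y Z x + koszul X Y' Z x := by
  have h1 := koszul_add_swap X (Y + Y') Z x
  have h2 := koszul_add_swap X Y Z x
  have h3 := koszul_add_swap X Y' Z x
  rw [koszul_add_right hX hZ hY hY', dMetric_add_left hY hY' hZ] at h1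
  linear_combination h1 - h2 - h3

theorem tensorialAt_koszul_left (hY : DiffFieldAt Y x) (hZ : DiffFieldAt Z x) :
    TensorialAt (𝓡 n) (EuclideanSpace ℝ (Fin n)) (fun X => koszul X Y Z x) x where
  smul hf hX := koszul_smul_left hf hX hY hZ
  add hX hX' := koszul_add_left hX hX' hY hZ

theorem tensorialAt_koszul_right (hX : DiffFieldAt X x) (hY : DiffFieldAt Y x) :
    TensorialAt (𝓡 n) (EuclideanSpace ℝ (Fin n)) (fun Z => koszul X Y Z x) x where
  smul hf hZ := koszul_smul_right hf hX hY hZ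
  add hZ hZ' := koszul_add_right hX hY hZ hZ'

theorem koszul_congr (hX : DiffFieldAt X x) (hX' : DiffFieldAt X' x) (hY : DiffFieldAt Y x)
    (hZ : DiffFieldAt Z x) (hZ' : DiffFieldAt Z' x) (h1 : X x = X' x) (h2 : Z x = Z' x) :
    koszul X Y Z x = koszul X' Y Z' x :=
  ((tensorialAt_koszul_left hY hZ).pointwise hX hX' h1).trans
    ((tensorialAt_koszul_right hX' hY).pointwise hZ hZ' h2)

/-- The Koszul formula holds for all fields, although `nabla` is defined by its values on chosen
extensions of the vectors of an orthonormal basis: the expression is tensorial in `X` and `Z`. -/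
theorem inner_nabla (hX : DiffFieldAt X x) (hY : DiffFieldAt Y x) (hZ : DiffFieldAt Z x) :
    inner ℝ (nabla Y x (X x)) (Z x) = koszul X Y Z x := by
  set b := stdOrthonormalBasis ℝ (Tan n x)
  have hu := diffFieldAt_ext (X x)
  have ht := tensorialAt_koszul_right hu hY
  have e1 : koszul X Y Z x =
      ∑ k, (inner ℝ (b k) (Z x) : ℝ) * koszul (ext (X x)) Y (ext (b k)) x := by
    rw [koszul_congr hX hu hY hZ (diffFieldAt_ext (Z x)) (by simp) (by simp)]
    have hk : ∀ w, TensorialAt.mkHom _ x ht w = koszul (ext (X x)) Y (ext w) x := fun w => rfl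
    rw [← hk]
    conv_lhs => rw [← b.sum_repr' (Z x)]
    rw [map_sum]
    refine Finset.sum_congr rfl fun k _ => ?_
    rw [map_smul, hk, smul_eq_mul]
  rw [e1, nabla, sum_inner]
  refine Finset.sum_congr rfl fun k _ => ?_
  rw [real_inner_smul_left, mul_comm]

end Connection

/-! ### Orthonormalization of smooth fields -/

section Frames

variable {n : ℕ} {M : Type*} [TopologicalSpace M] [ChartedSpace (EuclideanSpace ℝ (Fin n)) M]
  [IsManifold (𝓡 n) ∞ M] [RiemannianBundle (fun x : M => TangentSpace (𝓡 n) x)]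
  [IsContMDiffRiemannianBundle (𝓡 n) ∞ (EuclideanSpace ℝ (Fin n))
      (fun x : M => TangentSpace (𝓡 n) x)]

/-- The vector field `X` is `C^∞` at `x`. -/
abbrev SmoothFieldAt (X : ∀ x : M, Tan n x) (x : M) : Prop :=
  ContMDiffAt (𝓡 n) ((𝓡 n).prod 𝓘(ℝ, EuclideanSpace ℝ (Fin n))) ∞
    (fun x => (⟨x, X x⟩ : TangentBundle (𝓡 n) M)) x

variable {x : M} {X Y : ∀ x : M, Tan n x} {m : ℕ}

theorem SmoothFieldAt.diffFieldAt (hX : SmoothFieldAt X x) : DiffFieldAt X x :=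
  hX.mdifferentiableAt (by simp)

theorem SmoothFieldOn.smoothFieldAt {U : Set M} (hX : SmoothFieldOn X U) (hU : IsOpen U)
    (hx : x ∈ U) : SmoothFieldAt X x :=
  hX.contMDiffAt (hU.mem_nhds hx)

theorem smoothFieldOn_iff {U : Set M} (hU : IsOpen U) :
    SmoothFieldOn X U ↔ ∀ x ∈ U, SmoothFieldAt X x :=
  ⟨fun h _ hx => h.smoothFieldAt hU hx, fun h x hx => (h x hx).contMDiffWithinAt⟩

theorem SmoothFieldAt.inner_field (hX : SmoothFieldAt X x) (hY : SmoothFieldAt Y x) :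
    ContMDiffAt (𝓡 n) 𝓘(ℝ) ∞ (fun y => (inner ℝ (X y) (Y y) : ℝ)) x :=
  ContMDiffAt.inner_bundle (IB := 𝓡 n) (F := EuclideanSpace ℝ (Fin n))
    (E := fun x : M => TangentSpace (𝓡 n) x) hX hY

theorem SmoothFieldAt.inv_norm (hX : SmoothFieldAt X x) (h0 : X x ≠ 0) :
    ContMDiffAt (𝓡 n) 𝓘(ℝ) ∞ (fun y => ‖X y‖⁻¹) x := by
  have h1 : (inner ℝ (X x) (X x) : ℝ) ≠ 0 := by
    rw [ne_eq, inner_self_eq_zero]; exact h0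
  have h2 : Real.sqrt (inner ℝ (X x) (X x)) ≠ 0 := by
    rw [← norm_eq_sqrt_real_inner]; exact norm_ne_zero_iff.2 h0
  have h3 : ContDiffAt ℝ ∞ (fun t : ℝ => (Real.sqrt t)⁻¹) (inner ℝ (X x) (X x)) :=
    (Real.contDiffAt_sqrt h1).inv h2
  have := ContMDiffAt.comp x h3.contMDiffAt (hX.inner_field hX)
  refine this.congr_of_eventuallyEq (Eventually.of_forall fun y => ?_)
  simp only [Function.comp_apply, norm_eq_sqrt_real_inner (X y)]

/-- By induction along the recursion of the Gram-Schmidt process, in which only vectors that do not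
vanish at `x` are divided by the square of their length. -/
theorem smoothFieldAt_gramSchmidt {s : Fin m → ∀ x : M, Tan n x} (hs : ∀ i, SmoothFieldAt (s i) x)
    (h0 : ∀ i, InnerProductSpace.gramSchmidt ℝ (fun i => s i x) i ≠ 0) (i : Fin m) :
    SmoothFieldAt (fun y => InnerProductSpace.gramSchmidt ℝ (fun i => s i y) i) x := by
  induction i using WellFoundedLT.induction with
  | ind i ih =>
    have hterm : ∀ j ∈ Finset.Iio i, SmoothFieldAt (fun y =>
        ((inner ℝ (InnerProductSpace.gramSchmidt ℝ (fun i => s i y) j) (s i y) : ℝ) *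
          (‖InnerProductSpace.gramSchmidt ℝ (fun i => s i y) j‖⁻¹ *
            ‖InnerProductSpace.gramSchmidt ℝ (fun i => s i y) j‖⁻¹)) •
          InnerProductSpace.gramSchmidt ℝ (fun i => s i y) j) x := by
      intro j hj
      have hj' := ih j (Finset.mem_Iio.1 hj)
      have hinv := SmoothFieldAt.inv_norm hj' (h0 j)
      exact ((hj'.inner_field (hs i)).mul (hinv.mul hinv)).smul_section hj'
    have hsum := ContMDiffAt.sum_section hterm
    have := (hs i).sub_section hsum
    refine this.congr_of_eventuallyEq (Eventually.of_forall fun y => ?_)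
    simp only [TotalSpace.mk_inj, Pi.sub_apply]
    have hd := InnerProductSpace.gramSchmidt_def'' ℝ (fun i => s i y) i
    rw [eq_sub_iff_add_eq]
    conv_rhs => rw [hd]
    congr 1
    refine Finset.sum_congr rfl fun j _ => ?_
    congr 1
    simp only [RCLike.ofReal_real_eq_id, id]
    rw [div_eq_mul_inv, sq, mul_inv]

theorem smoothFieldAt_gramSchmidtNormed {s : Fin m → ∀ x : M, Tan n x}
    (hs : ∀ i, SmoothFieldAt (s i) x)
    (h0 : ∀ i, InnerProductSpace.gramSchmidt ℝ (fun i => s i x) i ≠ 0) (i : Fin m) :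
    SmoothFieldAt (fun y => InnerProductSpace.gramSchmidtNormed ℝ (fun i => s i y) i) x := by
  have h := smoothFieldAt_gramSchmidt hs h0 i
  exact (SmoothFieldAt.inv_norm h (h0 i)).smul_section h

/-- Smooth fields that are linearly independent at a point are so nearby, and their Gram-Schmidt
orthonormalization is smooth. -/
theorem exists_orthonormal_of_linearIndependent {s : Fin m → ∀ x : M, Tan n x} {U : Set M}
    (hU : IsOpen U) (hx : x ∈ U) (hs : ∀ i, SmoothFieldOn (s i) U)
    (hli : LinearIndependent ℝ (fun i => s i x)) :
    ∃ U' ⊆ U, IsOpen U' ∧ x ∈ U' ∧ ∃ E : Fin m → ∀ x : M, Tan n x,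
      (∀ i, SmoothFieldOn (E i) U') ∧ ∀ y ∈ U', Orthonormal ℝ (fun i => E i y) ∧
        ∀ i, E i y ∈ Submodule.span ℝ ((fun i => s i y) '' Set.Iic i) := by
  have h0 : ∀ i, InnerProductSpace.gramSchmidt ℝ (fun i => s i x) i ≠ 0 := fun i =>
    InnerProductSpace.gramSchmidt_ne_zero i hli
  have hev : ∀ᶠ y in 𝓝 x, ∀ i, InnerProductSpace.gramSchmidt ℝ (fun i => s i y) i ≠ 0 := by
    rw [eventually_all]
    intro i
    have h := smoothFieldAt_gramSchmidt (fun i => (hs i).smoothFieldAt hU hx) h0 i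
    have hc := (h.inner_field h).continuousAt
    have hne : (inner ℝ (InnerProductSpace.gramSchmidt ℝ (fun i => s i x) i)
        (InnerProductSpace.gramSchmidt ℝ (fun i => s i x) i) : ℝ) ≠ 0 := by
      rw [ne_eq, inner_self_eq_zero]; exact h0 i
    filter_upwards [hc.eventually_ne hne] with y hy
    rw [ne_eq, inner_self_eq_zero] at hy
    exact hy
  obtain ⟨U', hU'⟩ := eventually_nhds_iff.1 (hev.and (hU.mem_nhds hx))
  refine ⟨U', fun y hy => (hU'.1 y hy).2, hU'.2.1, hU'.2.2,
    fun i y => InnerProductSpace.gramSchmidtNormed ℝ (fun i => s i y) i, fun i => ?_,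
    fun y hy => ?_⟩
  · rw [smoothFieldOn_iff hU'.2.1]
    intro y hy
    exact smoothFieldAt_gramSchmidtNormed
      (fun i => (hs i).smoothFieldAt hU (hU'.1 y hy).2) (hU'.1 y hy).1 i
  · have hne := (hU'.1 y hy).1
    constructor
    · have := InnerProductSpace.gramSchmidtNormed_orthonormal' (𝕜 := ℝ) (fun i => s i y)
      have hne' : ∀ i, InnerProductSpace.gramSchmidtNormed ℝ (fun i => s i y) i ≠ 0 := fun i => by
        unfold InnerProductSpace.gramSchmidtNormed
        simpa using hne i
      exact Orthonormal.comp this (fun i => ⟨i, hne' i⟩) fun i j h => congrArg Subtype.val h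
    · intro i
      exact Submodule.smul_mem _ _
        (InnerProductSpace.gramSchmidt_mem_span ℝ (fun i => s i y) le_rfl)

end Frames

/-! ### Orthonormal frames adapted to a distribution -/

section
variable {E : Type*} [NormedAddCommGroup E] [InnerProductSpace ℝ E] [FiniteDimensional ℝ E]
  {ι : Type*} [Fintype ι]

theorem exists_orthonormalBasis_of_mem {K : Submodule ℝ E} {v : ι → E} (ho : Orthonormal ℝ v)
    (hm : ∀ i, v i ∈ K) (hc : Fintype.card ι = Module.finrank ℝ K) :
    ∃ b : OrthonormalBasis ι ℝ K, ∀ i, (b i : E) = v i := by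
  have ho' : Orthonormal ℝ (fun i => (⟨v i, hm i⟩ : K)) :=
    ho.codRestrict K hm
  refine ⟨OrthonormalBasis.mk ho'
    (ho'.linearIndependent.span_eq_top_of_card_eq_finrank' hc).ge, fun i => ?_⟩
  simp

theorem exists_linearIndependent_append {q r : ℕ} {f : Fin q → E} {g : Fin r → E}
    (hf : LinearIndependent ℝ f) (hg : LinearIndependent ℝ g)
    (hfg : ∀ i j, (inner ℝ (f i) (g j) : ℝ) = 0) : LinearIndependent ℝ (Fin.append f g) := by
  have hd : Submodule.span ℝ (range f) ⟂ Submodule.span ℝ (range g) := by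
    rw [Submodule.isOrtho_span]
    rintro _ ⟨i, rfl⟩ _ ⟨j, rfl⟩
    exact hfg i j
  have := hf.sum_type hg hd.disjoint
  have e : Fin.append f g ∘ finSumFinEquiv = Sum.elim f g := by
    ext i
    cases i <;> simp
  rw [← linearIndependent_equiv finSumFinEquiv, e]
  exact this

end

section Frames

variable {n : ℕ} {M : Type*} [TopologicalSpace M] [ChartedSpace (EuclideanSpace ℝ (Fin n)) M]
  [IsManifold (𝓡 n) ∞ M] [RiemannianBundle (fun x : M => TangentSpace (𝓡 n) x)]
  [IsContMDiffRiemannianBundle (𝓡 n) ∞ (EuclideanSpace ℝ (Fin n))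
      (fun x : M => TangentSpace (𝓡 n) x)]
  {σ : ∀ x : M, Submodule ℝ (Tan n x)} {x : M}

theorem finrank_tan (x : M) : Module.finrank ℝ (Tan n x) = n :=
  (finrank_euclideanSpace_fin : Module.finrank ℝ (EuclideanSpace ℝ (Fin n)) = n)

theorem dim_add_dim_orth (σ : ∀ x : M, Submodule ℝ (Tan n x)) (x : M) :
    dim σ x + dim (orth σ) x = n :=
  ((σ x).finrank_add_finrank_orthogonal).trans (finrank_tan x)

theorem exists_smoothFieldOn_ext (v : Tan n x) :
    ∃ U : Set M, IsOpen U ∧ x ∈ U ∧ SmoothFieldOn (ext v) U := by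
  obtain ⟨s, hs, h⟩ := FiberBundle.exists_contMDiffOn_extend (k := ∞) (𝓡 n)
    (EuclideanSpace ℝ (Fin n)) (V := fun x : M => TangentSpace (𝓡 n) x) v
  obtain ⟨U, hU, hUo, hxU⟩ := mem_nhds_iff.1 hs
  exact ⟨U, hUo, hxU, h.mono hU⟩

variable (σ) in
/-- A smooth orthonormal frame over `U`, made of a frame `V` of `σ` and a frame `H` of the
orthogonal distribution. -/
structure IsAdaptedFrame (U : Set M) {q r : ℕ} (V : Fin q → ∀ x : M, Tan n x)
    (H : Fin r → ∀ x : M, Tan n x) : Prop where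
  isOpen : IsOpen U
  smooth_V : ∀ i, SmoothFieldOn (V i) U
  smooth_H : ∀ i, SmoothFieldOn (H i) U
  orthonormal_V : ∀ y ∈ U, Orthonormal ℝ (fun i => V i y)
  orthonormal_H : ∀ y ∈ U, Orthonormal ℝ (fun i => H i y)
  mem_V : ∀ y ∈ U, ∀ i, V i y ∈ σ y
  mem_H : ∀ y ∈ U, ∀ i, H i y ∈ orth σ y
  dim_V : ∀ y ∈ U, dim σ y = q
  dim_H : ∀ y ∈ U, dim (orth σ) y = r

/-- Members of the generating family whose values at `x` form a basis of `σ x` span `σ` near `x`,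
because the dimension is constant. With extensions of a basis of the orthogonal complement appended,
Gram-Schmidt turns them into an adapted frame. -/
theorem exists_isAdaptedFrame (hσ : IsSmooth σ) (hx : x ∈ regularSet σ) :
    ∃ (U : Set M) (V : Fin (dim σ x) → ∀ x : M, Tan n x)
      (H : Fin (dim (orth σ) x) → ∀ x : M, Tan n x), x ∈ U ∧ IsAdaptedFrame σ U V H := by
  obtain ⟨D, hD, hspan⟩ := hσ
  -- Members of `D` whose values at `x` form a basis of `σ x`.
  have hf : ∃ f : Fin (dim σ x) → Tan n x,
      (∀ i, f i ∈ {v | ∃ p ∈ D, x ∈ p.1 ∧ p.2 x = v}) ∧ LinearIndependent ℝ f := by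
    unfold dim
    rw [hspan]
    obtain ⟨f, h1, -, h3⟩ := Submodule.exists_fun_fin_finrank_span_eq ℝ
      {v | ∃ p ∈ D, x ∈ p.1 ∧ p.2 x = v}
    exact ⟨f, h1, h3⟩
  obtain ⟨f, hfD, hfli⟩ := hf
  choose p hpD hxp hpf using hfD
  let b' : OrthonormalBasis (Fin (dim (orth σ) x)) ℝ (orth σ x) := stdOrthonormalBasis ℝ (orth σ x)
  choose U₁ hU₁ hxU₁ hsm₁ using fun j => exists_smoothFieldOn_ext (b' j : Tan n x)
  obtain ⟨U₂, hdim, hU₂, hxU₂⟩ := eventually_nhds_iff.1 hx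
  set U₀ : Set M := (⋂ i, (p i).1) ∩ (⋂ j, U₁ j) ∩ U₂ with hU₀def
  have hU₀ : IsOpen U₀ :=
    ((isOpen_iInter_of_finite fun i => (hD _ (hpD i)).1).inter (isOpen_iInter_of_finite hU₁)).inter
      hU₂
  have hxU₀ : x ∈ U₀ := ⟨⟨mem_iInter.2 hxp, mem_iInter.2 hxU₁⟩, hxU₂⟩
  let s : Fin (dim σ x + dim (orth σ) x) → ∀ x : M, Tan n x :=
    Fin.append (fun i => (p i).2) (fun j => ext (b' j : Tan n x))
  have hs : ∀ k, SmoothFieldOn (s k) U₀ := by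
    intro k
    refine Fin.addCases (fun i => ?_) (fun j => ?_) k
    · simp only [s, Fin.append_left]
      exact (hD _ (hpD i)).2.mono fun y hy => mem_iInter.1 hy.1.1 i
    · simp only [s, Fin.append_right]
      exact (hsm₁ j).mono fun y hy => mem_iInter.1 hy.1.2 j
  have hli : LinearIndependent ℝ (fun k => s k x) := by
    have hfσ : ∀ i, f i ∈ σ x := fun i => by
      rw [hspan]
      exact Submodule.subset_span ⟨p i, hpD i, hxp i, hpf i⟩
    have hg : LinearIndependent ℝ (fun j => (b' j : Tan n x)) :=
      b'.toBasis.linearIndependent.map' (orth σ x).subtype (Submodule.ker_subtype _) |> fun h => by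
        simpa [Function.comp_def] using h
    have := exists_linearIndependent_append hfli hg
      (fun i j => Submodule.inner_right_of_mem_orthogonal (hfσ i) (b' j).2)
    have e : (fun k => s k x) = Fin.append f (fun j => (b' j : Tan n x)) := by
      funext k
      refine Fin.addCases (fun i => ?_) (fun j => ?_) k
      · simp only [s, Fin.append_left, hpf]
      · simp only [s, Fin.append_right, ext_self]
    rw [e]
    exact this
  obtain ⟨U', hU'U₀, hU', hxU', E, hE, hEy⟩ :=
    exists_orthonormal_of_linearIndependent hU₀ hxU₀ hs hli
  have hdV : ∀ y ∈ U', dim σ y = dim σ x := fun y hy => hdim y (hU'U₀ hy).2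
  have hdH : ∀ y ∈ U', dim (orth σ) y = dim (orth σ) x := fun y hy => by
    have h1 := dim_add_dim_orth σ x
    have h2 := dim_add_dim_orth σ y
    have h3 := hdV y hy
    omega
  have hV : ∀ y ∈ U', ∀ i, E (Fin.castAdd _ i) y ∈ σ y := by
    intro y hy i
    refine (Submodule.span_le.2 ?_) ((hEy y hy).2 (Fin.castAdd _ i))
    rintro _ ⟨k, hk, rfl⟩
    obtain ⟨i', rfl⟩ : ∃ i', k = Fin.castAdd _ i' :=
      ⟨⟨k, lt_of_le_of_lt (Fin.le_def.1 hk) i.2⟩, rfl⟩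
    simp only [s, Fin.append_left]
    rw [SetLike.mem_coe, hspan]
    exact Submodule.subset_span ⟨p i', hpD i', mem_iInter.1 (hU'U₀ hy).1.1 i', rfl⟩
  have hoV : ∀ y ∈ U', Orthonormal ℝ (fun i : Fin (dim σ x) => E (Fin.castAdd _ i) y) := fun y hy =>
    Orthonormal.comp (hEy y hy).1 _ (Fin.castAdd_injective _ _)
  refine ⟨U', fun i => E (Fin.castAdd _ i), fun j => E (Fin.natAdd _ j), hxU', hU',
    fun i => hE _, fun j => hE _, hoV, fun y hy =>
      Orthonormal.comp (hEy y hy).1 _ (Fin.natAdd_injective _ _), hV, ?_, hdV, hdH⟩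
  intro y hy j
  obtain ⟨b, hb⟩ := exists_orthonormalBasis_of_mem (hoV y hy) (hV y hy)
    (by rw [Fintype.card_fin]; exact (hdV y hy).symm)
  rw [orth, Submodule.mem_orthogonal]
  intro v hv
  have h1 := congrArg (fun w : σ y => (w : Tan n y)) (b.sum_repr' ⟨v, hv⟩)
  simp only [Submodule.coe_sum, Submodule.coe_smul, hb] at h1
  rw [← h1, sum_inner]
  refine Finset.sum_eq_zero fun i _ => ?_
  have hne : Fin.castAdd (dim (orth σ) x) i ≠ Fin.natAdd (dim σ x) j := by
    intro h
    have := congrArg Fin.val h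
    simp at this
    omega
  rw [real_inner_smul_left]
  have h0 : (inner ℝ (E (Fin.castAdd (dim (orth σ) x) i) y)
      (E (Fin.natAdd (dim σ x) j) y) : ℝ) = 0 :=
    (hEy y hy).1.2 hne
  rw [h0, mul_zero]

end Frames

/-! ### The almost-product structure -/

section Torsion

variable {n : ℕ} {M : Type*} [TopologicalSpace M] [ChartedSpace (EuclideanSpace ℝ (Fin n)) M]
  [IsManifold (𝓡 n) ∞ M] [RiemannianBundle (fun x : M => TangentSpace (𝓡 n) x)]
  [IsContMDiffRiemannianBundle (𝓡 n) ∞ (EuclideanSpace ℝ (Fin n))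
      (fun x : M => TangentSpace (𝓡 n) x)]
  {σ : ∀ x : M, Submodule ℝ (Tan n x)} {x : M} {Y : ∀ x : M, Tan n x}

theorem almostProduct_eq_reflection (σ : ∀ x : M, Submodule ℝ (Tan n x)) (x : M) (v : Tan n x) :
    almostProduct σ x v = (σ x).reflection v := by
  rw [almostProduct, Submodule.reflection_apply, two_smul, two_smul]

theorem almostProduct_almostProduct (σ : ∀ x : M, Submodule ℝ (Tan n x)) (x : M) (v : Tan n x) :
    almostProduct σ x (almostProduct σ x v) = v := by
  simp only [almostProduct_eq_reflection, Submodule.reflection_reflection]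

theorem inner_almostProduct (σ : ∀ x : M, Submodule ℝ (Tan n x)) (x : M) (v w : Tan n x) :
    (inner ℝ (almostProduct σ x v) (almostProduct σ x w) : ℝ) = inner ℝ v w := by
  simp only [almostProduct_eq_reflection, LinearIsometryEquiv.inner_map_map]

theorem inner_almostProduct_left (σ : ∀ x : M, Submodule ℝ (Tan n x)) (x : M) (v w : Tan n x) :
    (inner ℝ (almostProduct σ x v) w : ℝ) = inner ℝ v (almostProduct σ x w) := by
  rw [← inner_almostProduct σ x v, almostProduct_almostProduct]

theorem almostProduct_of_mem {v : Tan n x} (hv : v ∈ σ x) : almostProduct σ x v = v := by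
  rw [almostProduct_eq_reflection, Submodule.reflection_mem_subspace_eq_self hv]

theorem almostProduct_of_mem_orth {v : Tan n x} (hv : v ∈ orth σ x) : almostProduct σ x v = -v := by
  rw [almostProduct_eq_reflection, Submodule.reflection_mem_subspace_orthogonalComplement_eq_neg hv]

theorem IsAdaptedFrame.exists_basis_V {U : Set M} {q r : ℕ} {V : Fin q → ∀ x : M, Tan n x}
    {H : Fin r → ∀ x : M, Tan n x} (h : IsAdaptedFrame σ U V H) {y : M} (hy : y ∈ U) :
    ∃ b : OrthonormalBasis (Fin q) ℝ (σ y), ∀ i, (b i : Tan n y) = V i y :=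
  exists_orthonormalBasis_of_mem (h.orthonormal_V y hy) (h.mem_V y hy)
    (by rw [Fintype.card_fin]; exact (h.dim_V y hy).symm)

theorem IsAdaptedFrame.exists_basis_H {U : Set M} {q r : ℕ} {V : Fin q → ∀ x : M, Tan n x}
    {H : Fin r → ∀ x : M, Tan n x} (h : IsAdaptedFrame σ U V H) {y : M} (hy : y ∈ U) :
    ∃ b : OrthonormalBasis (Fin r) ℝ (orth σ y), ∀ i, (b i : Tan n y) = H i y :=
  exists_orthonormalBasis_of_mem (h.orthonormal_H y hy) (h.mem_H y hy)
    (by rw [Fintype.card_fin]; exact (h.dim_H y hy).symm)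

theorem IsAdaptedFrame.almostProduct_eq {U : Set M} {q r : ℕ} {V : Fin q → ∀ x : M, Tan n x}
    {H : Fin r → ∀ x : M, Tan n x} (h : IsAdaptedFrame σ U V H) {y : M} (hy : y ∈ U)
    (v : Tan n y) :
    almostProduct σ y v = (2 : ℝ) • ∑ i, (inner ℝ (V i y) v : ℝ) • V i y - v := by
  obtain ⟨b, hb⟩ := h.exists_basis_V hy
  rw [almostProduct, Submodule.starProjection_apply, b.orthogonalProjectionOnto_apply_eq_sum]
  simp only [Submodule.coe_sum, Submodule.coe_smul, hb]

/-- The field `P Y`, with `P` the almost-product structure of `σ`. At each point, `P` is the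
orthogonal reflection in `σ x`. -/
noncomputable def reflField (σ : ∀ x : M, Submodule ℝ (Tan n x)) (Y : ∀ x : M, Tan n x) :
    ∀ x : M, Tan n x :=
  fun y => almostProduct σ y (Y y)

@[simp] theorem reflField_reflField (σ : ∀ x : M, Submodule ℝ (Tan n x)) (Y : ∀ x : M, Tan n x) :
    reflField σ (reflField σ Y) = Y :=
  funext fun y => almostProduct_almostProduct σ y (Y y)

theorem DiffFieldAt.reflField (hσ : IsSmooth σ) (hx : x ∈ regularSet σ) (hY : DiffFieldAt Y x) :
    DiffFieldAt (reflField σ Y) x := by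
  obtain ⟨U, V, H, hxU, h⟩ := exists_isAdaptedFrame hσ hx
  have hV : ∀ i, DiffFieldAt (V i) x := fun i =>
    ((h.smooth_V i).smoothFieldAt h.isOpen hxU).diffFieldAt
  have hterm : ∀ i ∈ Finset.univ, DiffFieldAt (fun y => (inner ℝ (V i y) (Y y) : ℝ) • V i y) x :=
    fun i _ => ((hV i).inner_field hY).smul_section (hV i)
  have h1 := MDifferentiableAt.sum_section hterm
  have h2 : DiffFieldAt (fun y => (2 : ℝ) • ∑ i, (inner ℝ (V i y) (Y y) : ℝ) • V i y) x :=
    (mdifferentiableAt_const (c := (2 : ℝ))).smul_section h1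
  have h3 := mdifferentiableAt_sub_section h2 hY
  refine h3.congr_of_eventuallyEq ?_
  filter_upwards [h.isOpen.mem_nhds hxU] with y hy
  simp only [TotalSpace.mk_inj, Pi.sub_apply]
  exact h.almostProduct_eq hy (Y y)

theorem SmoothFieldAt.reflField (hσ : IsSmooth σ) (hx : x ∈ regularSet σ) (hY : SmoothFieldAt Y x) :
    SmoothFieldAt (reflField σ Y) x := by
  obtain ⟨U, V, H, hxU, h⟩ := exists_isAdaptedFrame hσ hx
  have hV : ∀ i, SmoothFieldAt (V i) x := fun i =>
    (h.smooth_V i).smoothFieldAt h.isOpen hxU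
  have hterm : ∀ i ∈ Finset.univ, SmoothFieldAt (fun y => (inner ℝ (V i y) (Y y) : ℝ) • V i y) x :=
    fun i _ => ((hV i).inner_field hY).smul_section (hV i)
  have h1 := ContMDiffAt.sum_section hterm
  have h2 : SmoothFieldAt (fun y => (2 : ℝ) • ∑ i, (inner ℝ (V i y) (Y y) : ℝ) • V i y) x :=
    ContMDiffAt.const_smul_section h1
  have h3 := ContMDiffAt.sub_section h2 hY
  refine h3.congr_of_eventuallyEq ?_
  filter_upwards [h.isOpen.mem_nhds hxU] with y hy
  simp only [TotalSpace.mk_inj, Pi.sub_apply]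
  exact h.almostProduct_eq hy (Y y)

end Torsion

/-! ### Algebraic properties of the intrinsic torsion -/

section Torsion

variable {n : ℕ} {M : Type*} [TopologicalSpace M] [ChartedSpace (EuclideanSpace ℝ (Fin n)) M]
  [IsManifold (𝓡 n) ∞ M] [RiemannianBundle (fun x : M => TangentSpace (𝓡 n) x)]
  [IsContMDiffRiemannianBundle (𝓡 n) ∞ (EuclideanSpace ℝ (Fin n))
      (fun x : M => TangentSpace (𝓡 n) x)]
  {σ : ∀ x : M, Submodule ℝ (Tan n x)} {x : M} {X Y Z X' Y' Z' : ∀ x : M, Tan n x}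

theorem reflField_smul (f : M → ℝ) (Y : ∀ x : M, Tan n x) :
    reflField σ (f • Y) = f • reflField σ Y := by
  funext y
  simp [reflField, almostProduct_eq_reflection]

theorem reflField_add (Y Y' : ∀ x : M, Tan n x) :
    reflField σ (Y + Y') = reflField σ Y + reflField σ Y' := by
  funext y
  simp [reflField, almostProduct_eq_reflection]

/-- The function `½ (g(∇_X Y, Z) - g(∇_X (P Y), P Z))`, which is the component `g(ξ_X Y, Z)` of the
intrinsic torsion. -/
noncomputable def torsionForm (σ : ∀ x : M, Submodule ℝ (Tan n x)) (X Y Z : ∀ x : M, Tan n x)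
    (x : M) : ℝ :=
  (1 / 2) * (koszul X Y Z x - koszul X (reflField σ Y) (reflField σ Z) x)

section
variable (hP : ∀ Y, DiffFieldAt Y x → DiffFieldAt (reflField σ Y) x)
include hP

/-- The two derivative terms of the Leibniz rule cancel, because `P` is an isometry. -/
theorem tensorialAt_torsionForm_middle (hX : DiffFieldAt X x) (hZ : DiffFieldAt Z x) :
    TensorialAt (𝓡 n) (EuclideanSpace ℝ (Fin n)) (fun Y => torsionForm σ X Y Z x) x where
  smul {f Y} hf hY := by
    have h : (inner ℝ (reflField σ Y x) (reflField σ Z x) : ℝ) = inner ℝ (Y x) (Z x) :=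
      inner_almostProduct σ x _ _
    simp only [torsionForm, reflField_smul]
    rw [koszul_smul_middle hf hX hY hZ, koszul_smul_middle hf hX (hP _ hY) (hP _ hZ), h,
      smul_eq_mul]
    ring
  add {Y Y'} hY hY' := by
    simp only [torsionForm, reflField_add]
    rw [koszul_add_middle hX hY hY' hZ, koszul_add_middle hX (hP _ hY) (hP _ hY') (hP _ hZ)]
    ring

theorem torsionForm_congr (hX : DiffFieldAt X x) (hX' : DiffFieldAt X' x) (hY : DiffFieldAt Y x)
    (hY' : DiffFieldAt Y' x) (hZ : DiffFieldAt Z x) (hZ' : DiffFieldAt Z' x) (h1 : X x = X' x)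
    (h2 : Y x = Y' x) (h3 : Z x = Z' x) : torsionForm σ X Y Z x = torsionForm σ X' Y' Z' x := by
  rw [(tensorialAt_torsionForm_middle hP hX hZ).pointwise hY hY' h2]
  have h4 : reflField σ Z x = reflField σ Z' x := by simp only [reflField, h3]
  unfold torsionForm
  rw [koszul_congr hX hX' hY' hZ hZ' h1 h3,
    koszul_congr hX hX' (hP _ hY') (hP _ hZ) (hP _ hZ') h1 h4]

/-- The extension by which `torsion` is defined does not matter, as `torsionForm` is tensorial. -/
theorem inner_torsion (hX : DiffFieldAt X x) (hY : DiffFieldAt Y x) (hZ : DiffFieldAt Z x) :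
    inner ℝ (torsion σ x (X x) (Y x)) (Z x) = torsionForm σ X Y Z x := by
  have he := diffFieldAt_ext (Y x)
  rw [torsionForm_congr hP hX hX hY he hZ hZ rfl (by simp) rfl]
  have h1 := inner_nabla hX he hZ
  have h2 := inner_nabla hX (hP _ he) (hP _ hZ)
  have h3 : reflField σ Z x = almostProduct σ x (Z x) := rfl
  have h4 : (fun y => almostProduct σ y (ext (Y x) y)) = reflField σ (ext (Y x)) := rfl
  rw [torsion, h4, inner_neg_left, real_inner_smul_left, inner_almostProduct_left, inner_sub_left,
    inner_almostProduct, ← h3, h2, h1, torsionForm]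
  ring

theorem torsion_add_left (u u' v : Tan n x) :
    torsion σ x (u + u') v = torsion σ x u v + torsion σ x u' v := by
  refine ext_inner_right ℝ fun w => ?_
  have hu := diffFieldAt_ext u
  have hu' := diffFieldAt_ext u'
  have hv := diffFieldAt_ext v
  have hw := diffFieldAt_ext w
  have h1 := inner_torsion hP hu hv hw
  have h2 := inner_torsion hP hu' hv hw
  have h3 := inner_torsion hP (mdifferentiableAt_add_section hu hu') hv hw
  unfold torsionForm at h1 h2 h3
  rw [koszul_add_left hu hu' hv hw, koszul_add_left hu hu' (hP _ hv) (hP _ hw)] at h3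
  simp only [Pi.add_apply, ext_self] at h1 h2 h3
  rw [inner_add_left, h1, h2, h3]
  ring

theorem torsion_smul_left (c : ℝ) (u v : Tan n x) :
    torsion σ x (c • u) v = c • torsion σ x u v := by
  refine ext_inner_right ℝ fun w => ?_
  have hu := diffFieldAt_ext u
  have hv := diffFieldAt_ext v
  have hw := diffFieldAt_ext w
  have hc : MDifferentiableAt (𝓡 n) 𝓘(ℝ) (fun _ : M => c) x := mdifferentiableAt_const
  have h1 := inner_torsion hP hu hv hw
  have h3 := inner_torsion hP (X := (fun _ : M => c) • ext u) (hc.smul_section hu) hv hw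
  unfold torsionForm at h1 h3
  rw [koszul_smul_left hc hu hv hw, koszul_smul_left hc hu (hP _ hv) (hP _ hw)] at h3
  simp only [Pi.smul_apply', ext_self] at h1 h3
  rw [real_inner_smul_left, h1, h3]
  ring

theorem torsion_add_right (u v v' : Tan n x) :
    torsion σ x u (v + v') = torsion σ x u v + torsion σ x u v' := by
  refine ext_inner_right ℝ fun w => ?_
  have hu := diffFieldAt_ext u
  have hv := diffFieldAt_ext v
  have hv' := diffFieldAt_ext v'
  have hw := diffFieldAt_ext w
  have h1 := inner_torsion hP hu hv hw
  have h2 := inner_torsion hP hu hv' hw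
  have h3 := inner_torsion hP hu (mdifferentiableAt_add_section hv hv') hw
  have h4 := (tensorialAt_torsionForm_middle hP hu hw).add hv hv'
  simp only [Pi.add_apply, ext_self] at h1 h2 h3 h4
  rw [inner_add_left, h1, h2, h3]
  exact h4

theorem torsion_smul_right (c : ℝ) (u v : Tan n x) :
    torsion σ x u (c • v) = c • torsion σ x u v := by
  refine ext_inner_right ℝ fun w => ?_
  have hu := diffFieldAt_ext u
  have hv := diffFieldAt_ext v
  have hw := diffFieldAt_ext w
  have hc : MDifferentiableAt (𝓡 n) 𝓘(ℝ) (fun _ : M => c) x := mdifferentiableAt_const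
  have h1 := inner_torsion hP hu hv hw
  have h3 := inner_torsion hP (Y := (fun _ : M => c) • ext v) hu (hc.smul_section hv) hw
  have h4 := (tensorialAt_torsionForm_middle hP hu hw).smul hc hv
  simp only [Pi.smul_apply', ext_self] at h1 h3 h4
  rw [real_inner_smul_left, h1, h3]
  exact h4

/-- `ξ_u` is skew-symmetric, because the connection and `P` preserve the metric. -/
theorem inner_torsion_skew (u v w : Tan n x) :
    (inner ℝ (torsion σ x u v) w : ℝ) = -inner ℝ (torsion σ x u w) v := by
  have hu := diffFieldAt_ext u
  have hv := diffFieldAt_ext v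
  have hw := diffFieldAt_ext w
  have h1 := inner_torsion hP hu hv hw
  have h2 := inner_torsion hP hu hw hv
  simp only [ext_self] at h1 h2
  rw [h1, h2]
  have h3 := koszul_add_swap (ext u) (ext v) (ext w) x
  have h4 := koszul_add_swap (ext u) (reflField σ (ext v)) (reflField σ (ext w)) x
  have h5 : dMetric (reflField σ (ext v)) (reflField σ (ext w)) x = dMetric (ext v) (ext w) x := by
    funext z
    simp only [dMetric, reflField, inner_almostProduct]
  rw [h5, ← h3] at h4
  unfold torsionForm
  linear_combination (-1 / 2) * h4

/-- `ξ_u` anticommutes with `P`. -/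
theorem inner_torsion_almostProduct (u v w : Tan n x) :
    (inner ℝ (torsion σ x u (almostProduct σ x v)) (almostProduct σ x w) : ℝ) =
      -inner ℝ (torsion σ x u v) w := by
  have hu := diffFieldAt_ext u
  have hv := diffFieldAt_ext v
  have hw := diffFieldAt_ext w
  have h1 := inner_torsion hP hu hv hw
  have h2 := inner_torsion hP hu (hP _ hv) (hP _ hw)
  simp only [ext_self, reflField] at h1 h2
  rw [h1, h2]
  unfold torsionForm
  rw [reflField_reflField, reflField_reflField]
  ring

theorem torsion_mem_orth {u v : Tan n x} (hv : v ∈ σ x) : torsion σ x u v ∈ orth σ x := by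
  rw [orth, Submodule.mem_orthogonal']
  intro w hw
  have h := inner_torsion_almostProduct hP u v w
  rw [almostProduct_of_mem hv, almostProduct_of_mem hw] at h
  linarith

theorem torsion_mem {u v : Tan n x} (hv : v ∈ orth σ x) : torsion σ x u v ∈ σ x := by
  rw [← Submodule.orthogonal_orthogonal (σ x), Submodule.mem_orthogonal']
  intro w hw
  have h := inner_torsion_almostProduct hP u v w
  rw [almostProduct_of_mem_orth hv, almostProduct_of_mem_orth hw] at h
  have h' := torsion_smul_right hP (-1) u v
  rw [neg_one_smul, neg_one_smul] at h'
  rw [h', inner_neg_neg] at h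
  linarith

end

/-- The Koszul expression depends on `Y` only through its germ. It is not tensorial in `Y`. -/
theorem koszul_congr_middle (h : ∀ᶠ y in 𝓝 x, Y y = Y' y) :
    koszul X Y Z x = koszul X Y' Z x := by
  have hd : ∀ W : ∀ x : M, Tan n x, dMetric Y W x = dMetric Y' W x := fun W => by
    funext z
    unfold dMetric mvfderiv
    have : (fun y => (inner ℝ (Y y) (W y) : ℝ)) =ᶠ[𝓝 x] fun y => (inner ℝ (Y' y) (W y) : ℝ) := by
      filter_upwards [h] with y hy
      rw [hy]
    rw [this.mfderiv_eq]
    congr 1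
  have h' : Y =ᶠ[𝓝 x] Y' := h
  have h0 : Y x = Y' x := h.self_of_nhds
  unfold koszul
  rw [hd, dMetric_comm X Y, hd, dMetric_comm Y' X,
    Filter.EventuallyEq.mlieBracket_vectorField_eq (EventuallyEq.refl _ X) h',
    Filter.EventuallyEq.mlieBracket_vectorField_eq h' (EventuallyEq.refl _ Z), h0]

theorem dMetric_eq_zero_of_const {c : ℝ} (h : ∀ᶠ y in 𝓝 x, (inner ℝ (Y y) (Z y) : ℝ) = c)
    (v : Tan n x) : dMetric Y Z x v = 0 := by
  unfold dMetric mvfderiv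
  have : (fun y => (inner ℝ (Y y) (Z y) : ℝ)) =ᶠ[𝓝 x] fun _ => c := h
  rw [this.mfderiv_eq, mfderiv_const]
  exact ContinuousLinearEquiv.map_zero (NormedSpace.fromTangentSpace (𝕜 := ℝ) _)

end Torsion

/-! ### The pointwise inequality -/

section Pointwise

variable {n : ℕ} {M : Type*} [TopologicalSpace M] [ChartedSpace (EuclideanSpace ℝ (Fin n)) M]
  [IsManifold (𝓡 n) ∞ M] [RiemannianBundle (fun x : M => TangentSpace (𝓡 n) x)]
  [IsContMDiffRiemannianBundle (𝓡 n) ∞ (EuclideanSpace ℝ (Fin n))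
      (fun x : M => TangentSpace (𝓡 n) x)]
  {σ W : ∀ x : M, Submodule ℝ (Tan n x)} {x : M}

/-- The intrinsic torsion at `x` as a bilinear map. -/
noncomputable def torsionLin (hP : ∀ Y, DiffFieldAt Y x → DiffFieldAt (reflField σ Y) x) :
    Tan n x →ₗ[ℝ] Tan n x →ₗ[ℝ] Tan n x :=
  LinearMap.mk₂ ℝ (torsion σ x) (torsion_add_left hP) (torsion_smul_left hP)
    (torsion_add_right hP) (torsion_smul_right hP)

/-- The sum of the `‖ξ_u v‖²` for `u`, `v` in an orthonormal basis of `W x`. -/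
noncomputable def torsionNormSqOn (σ W : ∀ x : M, Submodule ℝ (Tan n x)) (x : M) : ℝ :=
  ∑ a, ∑ b, ‖torsion σ x (stdOrthonormalBasis ℝ (W x) a : Tan n x)
    (stdOrthonormalBasis ℝ (W x) b : Tan n x)‖ ^ 2

theorem secondMeanCurvature_eq_sum_sumMinors (σ W : ∀ x : M, Submodule ℝ (Tan n x)) (x : M) :
    secondMeanCurvature σ W x = ∑ j, sumMinors (fun a b => torsionComp σ W x a b j) := rfl

/-- As `ξ_u v` is orthogonal to `W`, its components in a basis of the orthogonal complement
give all of its norm. -/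
theorem sum_torsionComp_sq (hW : ∀ u ∈ W x, ∀ v ∈ W x, torsion σ x u v ∈ orth W x) :
    ∑ j, ∑ a, ∑ b, torsionComp σ W x a b j ^ 2 = torsionNormSqOn σ W x := by
  rw [Finset.sum_comm]
  unfold torsionNormSqOn
  refine Finset.sum_congr rfl fun a _ => ?_
  rw [Finset.sum_comm]
  refine Finset.sum_congr rfl fun b _ => ?_
  have h := hW _ (stdOrthonormalBasis ℝ (W x) a).2 _ (stdOrthonormalBasis ℝ (W x) b).2
  rw [← real_inner_self_eq_norm_sq,
    ← sum_inner_mul_inner_of_mem (stdOrthonormalBasis ℝ (orth W x)) h h]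
  simp only [sq, torsionComp]

theorem secondMeanCurvature_div_le (hW : ∀ u ∈ W x, ∀ v ∈ W x, torsion σ x u v ∈ orth W x) :
    secondMeanCurvature σ W x / ((dim W x : ℝ) - 1) ≤ (1 / 2) * torsionNormSqOn σ W x := by
  rw [secondMeanCurvature_eq_sum_sumMinors, ← sum_torsionComp_sq hW, Finset.sum_div, Finset.mul_sum]
  exact Finset.sum_le_sum fun j _ => sumMinors_div_le _

theorem neg_secondMeanCurvature_div_le
    (hW : ∀ u ∈ W x, ∀ v ∈ W x, torsion σ x u v ∈ orth W x) :
    -(secondMeanCurvature σ W x / ((dim W x : ℝ) - 1)) ≤ (1 / 2) * torsionNormSqOn σ W x := by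
  rw [secondMeanCurvature_eq_sum_sumMinors, ← sum_torsionComp_sq hW, Finset.sum_div,
    Finset.mul_sum, ← Finset.sum_neg_distrib]
  exact Finset.sum_le_sum fun j _ => neg_sumMinors_div_le _

theorem secondMeanCurvature_eq (hW : ∀ u ∈ W x, ∀ v ∈ W x, torsion σ x u v ∈ orth W x) :
    secondMeanCurvature σ W x = (1 / 2) *
      (‖∑ a, torsion σ x (stdOrthonormalBasis ℝ (W x) a : Tan n x)
        (stdOrthonormalBasis ℝ (W x) a : Tan n x)‖ ^ 2
      - ∑ a, ∑ b, (inner ℝ (torsion σ x (stdOrthonormalBasis ℝ (W x) a : Tan n x)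
        (stdOrthonormalBasis ℝ (W x) b : Tan n x))
        (torsion σ x (stdOrthonormalBasis ℝ (W x) b : Tan n x)
        (stdOrthonormalBasis ℝ (W x) a : Tan n x)) : ℝ)) := by
  have hm : ∀ a b, torsion σ x (stdOrthonormalBasis ℝ (W x) a : Tan n x)
        (stdOrthonormalBasis ℝ (W x) b : Tan n x) ∈ orth W x := fun a b =>
    hW _ (stdOrthonormalBasis ℝ (W x) a).2 _ (stdOrthonormalBasis ℝ (W x) b).2
  have hs := Submodule.sum_mem (orth W x) (t := Finset.univ) (fun a _ => hm a a)
  rw [secondMeanCurvature_eq_sum_sumMinors, ← real_inner_self_eq_norm_sq,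
    ← sum_inner_mul_inner_of_mem (stdOrthonormalBasis ℝ (orth W x)) hs hs]
  simp only [sumMinors_eq, ← Finset.mul_sum, Finset.sum_sub_distrib]
  congr 2
  · refine Finset.sum_congr rfl fun j _ => ?_
    rw [sum_inner, sq]
    rfl
  · rw [Finset.sum_comm]
    refine Finset.sum_congr rfl fun a _ => ?_
    rw [Finset.sum_comm]
    refine Finset.sum_congr rfl fun b _ => ?_
    exact sum_inner_mul_inner_of_mem (stdOrthonormalBasis ℝ (orth W x)) (hm a b) (hm b a)

/-- A bilinear map on `W x` with values in `(W x)ᗮ` vanishes if its components do. -/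
theorem bilin_eq_zero_iff (D : W x →ₗ[ℝ] W x →ₗ[ℝ] Tan n x) (hD : ∀ u v, D u v ∈ orth W x) :
    (∀ u v, D u v = 0) ↔ ∀ (j : Fin (Module.finrank ℝ (orth W x)))
      (a b : Fin (Module.finrank ℝ (W x))), (inner ℝ (D (stdOrthonormalBasis ℝ (W x) a)
        (stdOrthonormalBasis ℝ (W x) b))
        (stdOrthonormalBasis ℝ (orth W x) j : Tan n x) : ℝ) = 0 := by
  constructor
  · intro h j a b
    rw [h, inner_zero_left]
  · intro h u v
    have hab : ∀ a b, D (stdOrthonormalBasis ℝ (W x) a) (stdOrthonormalBasis ℝ (W x) b) = 0 :=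
      fun a b => eq_zero_of_inner_eq_zero_of_mem (stdOrthonormalBasis ℝ (orth W x)) (hD _ _)
        fun j => h j a b
    have h0 : D = 0 := by
      refine (stdOrthonormalBasis ℝ (W x)).toBasis.ext fun a => ?_
      refine (stdOrthonormalBasis ℝ (W x)).toBasis.ext fun b => ?_
      simpa using hab a b
    rw [h0]; rfl

theorem secondForm_self (σ : ∀ x : M, Submodule ℝ (Tan n x)) (x : M) (u : Tan n x) :
    secondForm σ x u u = torsion σ x u u := by
  rw [secondForm, ← two_smul ℝ, smul_smul]
  norm_num

/-- The pointwise equality case, for one of the two distributions. The three conditions on the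
matrices `(ξ_ab^j)` are identities of bilinear maps on `W x`, read off in an orthonormal basis. -/
theorem secondMeanCurvature_div_eq_iff
    (hP : ∀ Y, DiffFieldAt Y x → DiffFieldAt (reflField σ Y) x)
    (hW : ∀ u ∈ W x, ∀ v ∈ W x, torsion σ x u v ∈ orth W x) :
    secondMeanCurvature σ W x / ((dim W x : ℝ) - 1) = (1 / 2) * torsionNormSqOn σ W x ↔
      (dim W x = 1 → ∀ u ∈ W x, ∀ v ∈ W x, secondForm σ x u v = 0) ∧
      (2 ≤ dim W x → ∀ u ∈ W x, ∀ v ∈ W x, secondForm σ x u v =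
        ((inner ℝ u v : ℝ) / (dim W x : ℝ)) • meanCurvature σ W x) ∧
      (3 ≤ dim W x → ∀ u ∈ W x, ∀ v ∈ W x, torsion σ x u v = torsion σ x v u) := by
  have hcomp : secondMeanCurvature σ W x / ((dim W x : ℝ) - 1) = (1 / 2) * torsionNormSqOn σ W x ↔
      ∀ j, sumMinors (fun a b => torsionComp σ W x a b j) / ((dim W x : ℝ) - 1) =
        (1 / 2) * ∑ a, ∑ b, torsionComp σ W x a b j ^ 2 := by
    rw [secondMeanCurvature_eq_sum_sumMinors, ← sum_torsionComp_sq hW, Finset.sum_div,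
      Finset.mul_sum]
    have h := Finset.sum_eq_sum_iff_of_le (s := Finset.univ)
      (f := fun j => sumMinors (fun a b => torsionComp σ W x a b j) / ((dim W x : ℝ) - 1))
      (g := fun j => (1 / 2) * ∑ a, ∑ b, torsionComp σ W x a b j ^ 2)
      (fun j _ => sumMinors_div_le _)
    exact h.trans (by simp)
  have hm := fun j => sumMinors_div_eq_iff (fun a b => torsionComp σ W x a b j)
  rw [hcomp]
  refine (forall_congr' hm).trans ?_
  -- The restrictions to `W x` of the bilinear maps whose vanishing expresses the conditions.
  let T : W x →ₗ[ℝ] W x →ₗ[ℝ] Tan n x :=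
    (torsionLin hP).compl₁₂ (W x).subtype (W x).subtype
  have hT : ∀ u v : W x, T u v = torsion σ x u v := fun u v => rfl
  let S : W x →ₗ[ℝ] W x →ₗ[ℝ] Tan n x := (1 / 2 : ℝ) • (T + T.flip)
  have hS : ∀ u v : W x, S u v = secondForm σ x u v := fun u v => rfl
  let G : W x →ₗ[ℝ] W x →ₗ[ℝ] Tan n x :=
    (innerₗ (W x)).compr₂ (LinearMap.toSpanSingleton ℝ (Tan n x)
      ((1 / (dim W x : ℝ)) • meanCurvature σ W x))
  have hG : ∀ u v : W x, G u v =
      ((inner ℝ (u : Tan n x) (v : Tan n x) : ℝ) / (dim W x : ℝ)) • meanCurvature σ W x :=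
    fun u v => by
      simp only [G, LinearMap.compr₂_apply, LinearMap.toSpanSingleton_apply, smul_smul,
        innerₗ_apply_apply]
      rw [mul_one_div]
      rfl
  have hTm : ∀ u v, T u v ∈ orth W x := fun u v => hW _ u.2 _ v.2
  have hSm : ∀ u v, S u v ∈ orth W x := fun u v =>
    Submodule.smul_mem _ _ (Submodule.add_mem _ (hTm u v) (hTm v u))
  have hHm : meanCurvature σ W x ∈ orth W x :=
    Submodule.sum_mem _ fun a _ =>
      hSm (stdOrthonormalBasis ℝ (W x) a) (stdOrthonormalBasis ℝ (W x) a)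
  have hGm : ∀ u v, G u v ∈ orth W x := fun u v => by
    rw [hG]; exact Submodule.smul_mem _ _ hHm
  have c1 := bilin_eq_zero_iff S hSm
  have c2 := bilin_eq_zero_iff (S - G) (fun u v => Submodule.sub_mem _ (hSm u v) (hGm u v))
  have c3 := bilin_eq_zero_iff (T - T.flip) (fun u v => Submodule.sub_mem _ (hTm u v) (hTm v u))
  have hScomp : ∀ j a b, (inner ℝ (S (stdOrthonormalBasis ℝ (W x) a)
      (stdOrthonormalBasis ℝ (W x) b)) (stdOrthonormalBasis ℝ (orth W x) j : Tan n x) : ℝ) =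
      (1 / 2) * (torsionComp σ W x a b j + torsionComp σ W x b a j) := fun j a b => by
    rw [hS, secondForm, real_inner_smul_left, inner_add_left]
    rfl
  have hGcomp : ∀ j a b, (inner ℝ (G (stdOrthonormalBasis ℝ (W x) a)
      (stdOrthonormalBasis ℝ (W x) b)) (stdOrthonormalBasis ℝ (orth W x) j : Tan n x) : ℝ) =
      (if a = b then 1 else 0) / (dim W x : ℝ) * ∑ c, torsionComp σ W x c c j := fun j a b => by
    have h1 : (inner ℝ (stdOrthonormalBasis ℝ (W x) a : Tan n x)
        (stdOrthonormalBasis ℝ (W x) b : Tan n x) : ℝ) = if a = b then 1 else 0 :=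
      orthonormal_iff_ite.1 (stdOrthonormalBasis ℝ (W x)).orthonormal a b
    rw [hG, real_inner_smul_left, h1, meanCurvature, sum_inner]
    simp only [secondForm_self]
    rfl
  have e1 : (∀ u ∈ W x, ∀ v ∈ W x, secondForm σ x u v = 0) ↔ ∀ u v, S u v = 0 := by
    simp only [hS, Subtype.forall]
  have e2 : (∀ u ∈ W x, ∀ v ∈ W x, secondForm σ x u v =
      ((inner ℝ u v : ℝ) / (dim W x : ℝ)) • meanCurvature σ W x) ↔ ∀ u v, (S - G) u v = 0 := by
    simp only [LinearMap.sub_apply, hS, hG, Subtype.forall, sub_eq_zero]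
  have e3 : (∀ u ∈ W x, ∀ v ∈ W x, torsion σ x u v = torsion σ x v u) ↔
      ∀ u v, (T - T.flip) u v = 0 := by
    simp only [LinearMap.sub_apply, LinearMap.flip_apply, hT, Subtype.forall, sub_eq_zero]
  rw [e1, e2, e3, c1, c2, c3]
  simp only [LinearMap.sub_apply, LinearMap.flip_apply, inner_sub_left, hScomp, hGcomp, sub_eq_zero]
  rw [forall_and, forall_and]
  refine and_congr ?_ (and_congr ?_ ?_)
  · rw [forall_comm]
    refine forall_congr' fun h1 => ?_
    have hsub : ∀ a b : Fin (Module.finrank ℝ (W x)), a = b := fun a b => by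
      have : Module.finrank ℝ (W x) = 1 := h1
      ext
      omega
    refine forall_congr' fun j => forall_congr' fun a => forall_congr' fun b => ?_
    rw [hsub b a]
    constructor <;> intro h <;> linarith
  · rw [forall_comm]
    rfl
  · rw [forall_comm]
    rfl

theorem exists_orthonormalBasis_sum {E : Type*} [NormedAddCommGroup E] [InnerProductSpace ℝ E]
    [FiniteDimensional ℝ E] {ι κ : Type*} [Fintype ι] [Fintype κ] {K : Submodule ℝ E}
    (b : OrthonormalBasis ι ℝ K) (c : OrthonormalBasis κ ℝ Kᗮ) :
    ∃ f : OrthonormalBasis (ι ⊕ κ) ℝ E,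
      (∀ i, f (Sum.inl i) = (b i : E)) ∧ ∀ j, f (Sum.inr j) = (c j : E) := by
  classical
  have ho : Orthonormal ℝ (Sum.elim (fun i => (b i : E)) (fun j => (c j : E))) := by
    rw [orthonormal_iff_ite]
    rintro (i | i) (j | j)
    · have := orthonormal_iff_ite.1 b.orthonormal i j
      simpa using this
    · simpa using Submodule.inner_right_of_mem_orthogonal (b i).2 (c j).2
    · simpa using Submodule.inner_left_of_mem_orthogonal (b j).2 (c i).2
    · have := orthonormal_iff_ite.1 c.orthonormal i j
      simpa using this
  have hc : Fintype.card (ι ⊕ κ) = Module.finrank ℝ E := by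
    rw [Fintype.card_sum, ← K.finrank_add_finrank_orthogonal,
      Module.finrank_eq_card_basis b.toBasis, Module.finrank_eq_card_basis c.toBasis]
  refine ⟨OrthonormalBasis.mk ho
    (ho.linearIndependent.span_eq_top_of_card_eq_finrank' hc).ge, fun i => ?_, fun j => ?_⟩ <;> simp

theorem torsion_mem_orth_of_mem_self
    (hP : ∀ Y, DiffFieldAt Y x → DiffFieldAt (reflField σ Y) x) :
    ∀ u ∈ σ x, ∀ v ∈ σ x, torsion σ x u v ∈ orth σ x :=
  fun _ _ _ hv => torsion_mem_orth hP hv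

theorem torsion_mem_orth_of_mem_orth
    (hP : ∀ Y, DiffFieldAt Y x → DiffFieldAt (reflField σ Y) x) :
    ∀ u ∈ orth σ x, ∀ v ∈ orth σ x, torsion σ x u v ∈ orth (orth σ) x :=
  fun _ _ _ hv => Submodule.le_orthogonal_orthogonal _ (torsion_mem hP hv)

/-- Since each `ξ_u` is skew-symmetric and exchanges `σ` and its orthogonal complement, `‖ξ‖²` is
determined by the components `ξ_u v` with `u` and `v` both tangent or both orthogonal to `σ`. -/
theorem torsionNormSq_eq (hP : ∀ Y, DiffFieldAt Y x → DiffFieldAt (reflField σ Y) x) :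
    torsionNormSq σ x = 2 * (torsionNormSqOn σ σ x + torsionNormSqOn σ (orth σ) x) := by
  set b := stdOrthonormalBasis ℝ (σ x) with hb
  set c := stdOrthonormalBasis ℝ (orth σ x) with hc
  obtain ⟨f, hfb, hfc⟩ : ∃ f : OrthonormalBasis (Fin (Module.finrank ℝ (σ x)) ⊕
      Fin (Module.finrank ℝ (orth σ x))) ℝ (Tan n x),
      (∀ i, f (Sum.inl i) = (b i : Tan n x)) ∧ ∀ j, f (Sum.inr j) = (c j : Tan n x) :=
    exists_orthonormalBasis_sum (K := σ x) b c
  have h1 := sum_normSq_bilin_orthonormalBasis (torsionLin hP) (stdOrthonormalBasis ℝ (Tan n x)) f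
  have h2 : torsionNormSq σ x = _ := h1
  have hlin : ∀ u v, torsionLin hP u v = torsion σ x u v := fun u v => rfl
  rw [h2]
  simp only [Fintype.sum_sum_type, hfb, hfc, hlin, Finset.sum_add_distrib]
  have e1 : ∀ u, ∑ j, ‖torsion σ x u (c j : Tan n x)‖ ^ 2 =
      ∑ a, ‖torsion σ x u (b a : Tan n x)‖ ^ 2 := by
    intro u
    have h3 : ∀ j, ‖torsion σ x u (c j : Tan n x)‖ ^ 2 =
        ∑ a, (inner ℝ (torsion σ x u (c j : Tan n x)) (b a : Tan n x) : ℝ) ^ 2 := fun j => by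
      have hm := torsion_mem hP (u := u) (c j).2
      rw [← real_inner_self_eq_norm_sq, ← sum_inner_mul_inner_of_mem b hm hm]
      simp only [sq]
    have h4 : ∀ a, ‖torsion σ x u (b a : Tan n x)‖ ^ 2 =
        ∑ j, (inner ℝ (torsion σ x u (b a : Tan n x)) (c j : Tan n x) : ℝ) ^ 2 := fun a => by
      have hm := torsion_mem_orth hP (u := u) (b a).2
      rw [← real_inner_self_eq_norm_sq, ← sum_inner_mul_inner_of_mem c hm hm]
      simp only [sq]
    simp only [h3, h4]
    rw [Finset.sum_comm]
    refine Finset.sum_congr rfl fun a _ => Finset.sum_congr rfl fun j _ => ?_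
    rw [inner_torsion_skew hP, neg_sq]
  simp only [e1]
  have e2 : ∑ j, ∑ a, ‖torsion σ x (c j : Tan n x) (b a : Tan n x)‖ ^ 2 =
      ∑ j, ∑ i, ‖torsion σ x (c j : Tan n x) (c i : Tan n x)‖ ^ 2 :=
    Finset.sum_congr rfl fun j _ => (e1 _).symm
  unfold torsionNormSqOn
  rw [e2]
  ring

end Pointwise

/-! ### Integrability of the distributions -/

section Integrability

variable {n : ℕ} {M : Type*} [TopologicalSpace M] [ChartedSpace (EuclideanSpace ℝ (Fin n)) M]
  [IsManifold (𝓡 n) ∞ M] [RiemannianBundle (fun x : M => TangentSpace (𝓡 n) x)]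
  [IsContMDiffRiemannianBundle (𝓡 n) ∞ (EuclideanSpace ℝ (Fin n))
      (fun x : M => TangentSpace (𝓡 n) x)]
  {σ W : ∀ x : M, Submodule ℝ (Tan n x)} {x : M} {X Y Z : ∀ x : M, Tan n x} {ε : ℝ}

/-- `W` is the eigendistribution of `P` for the eigenvalue `ε = ±1`: it is `σ` for `ε = 1` and the
orthogonal distribution for `ε = -1`. The predicate collects what the arguments that are common to
the two distributions use. The orthogonal distribution need not be smooth at singular points, so
that it cannot just be put in the place of `σ`. -/
structure IsEigendistribution (σ W : ∀ x : M, Submodule ℝ (Tan n x)) (ε : ℝ) : Prop where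
  mul_self : ε * ε = 1
  apply_of_mem : ∀ x, ∀ v ∈ W x, almostProduct σ x v = ε • v
  apply_of_mem_orth : ∀ x, ∀ v ∈ orth W x, almostProduct σ x v = -(ε • v)
  add_mem : ∀ x v, v + ε • almostProduct σ x v ∈ W x
  torsion_mem : ∀ x, (∀ Y, DiffFieldAt Y x → DiffFieldAt (reflField σ Y) x) →
    ∀ u ∈ W x, ∀ v ∈ W x, torsion σ x u v ∈ orth W x

theorem isEigendistribution_self (σ : ∀ x : M, Submodule ℝ (Tan n x)) :
    IsEigendistribution σ σ 1 where
  mul_self := one_mul 1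
  apply_of_mem x v hv := by rw [almostProduct_of_mem hv, one_smul]
  apply_of_mem_orth x v hv := by rw [almostProduct_of_mem_orth hv, one_smul]
  add_mem x v := by
    rw [almostProduct, one_smul, add_sub_cancel]
    exact Submodule.smul_mem _ _ (Submodule.starProjection_apply_mem _ _)
  torsion_mem x hP := torsion_mem_orth_of_mem_self hP

theorem isEigendistribution_orth (σ : ∀ x : M, Submodule ℝ (Tan n x)) :
    IsEigendistribution σ (orth σ) (-1) where
  mul_self := by norm_num
  apply_of_mem x v hv := by rw [almostProduct_of_mem_orth hv, neg_one_smul]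
  apply_of_mem_orth x v hv := by
    have hv' : v ∈ σ x := by rwa [orth, orth, Submodule.orthogonal_orthogonal] at hv
    rw [almostProduct_of_mem hv', neg_one_smul, neg_neg]
  add_mem x v := by
    have : v + (-1 : ℝ) • almostProduct σ x v = (2 : ℝ) • (v - (σ x).starProjection v) := by
      rw [almostProduct]
      module
    rw [this]
    exact Submodule.smul_mem _ _ (Submodule.sub_starProjection_mem_orthogonal _)
  torsion_mem x hP := torsion_mem_orth_of_mem_orth hP

/-- For a field `Y` of `W`, the torsion `ξ_X Y` is the component of `∇_X Y` orthogonal to `W`: here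
`P Y = ε Y` near `x` and `P Z = -ε Z` at `x`, so that the two halves of `torsionForm` agree. -/
theorem inner_torsion_of_eventually_mem (hE : IsEigendistribution σ W ε)
    (hP : ∀ Y, DiffFieldAt Y x → DiffFieldAt (reflField σ Y) x)
    (hX : DiffFieldAt X x) (hY : DiffFieldAt Y x) (hZ : DiffFieldAt Z x)
    (hYW : ∀ᶠ y in 𝓝 x, Y y ∈ W y) (hZW : Z x ∈ orth W x) :
    inner ℝ (torsion σ x (X x) (Y x)) (Z x) = koszul X Y Z x := by
  have hc : ∀ c : ℝ, MDifferentiableAt (𝓡 n) 𝓘(ℝ) (fun _ : M => c) x := fun c =>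
    mdifferentiableAt_const
  have h1 : koszul X (reflField σ Y) (reflField σ Z) x =
      koszul X ((fun _ : M => ε) • Y) (reflField σ Z) x := by
    refine koszul_congr_middle ?_
    filter_upwards [hYW] with y hy
    exact hE.apply_of_mem y _ hy
  have hεY : DiffFieldAt ((fun _ : M => ε) • Y) x := (hc ε).smul_section hY
  have h2 : koszul X ((fun _ : M => ε) • Y) (reflField σ Z) x =
      koszul X ((fun _ : M => ε) • Y) ((fun _ : M => -ε) • Z) x :=
    koszul_congr hX hX hεY (hP _ hZ) ((hc (-ε)).smul_section hZ) rfl (by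
      simp only [reflField, Pi.smul_apply', neg_smul]
      exact hE.apply_of_mem_orth x _ hZW)
  rw [koszul_smul_right (hc (-ε)) hX hεY hZ, koszul_smul_middle (hc ε) hX hY hZ,
    mvfderiv_const] at h2
  rw [inner_torsion hP hX hY hZ, torsionForm, h1, h2]
  simp only [zero_apply]
  linear_combination (1 / 2) * koszul X Y Z x * hE.mul_self

/-- The skew part of the torsion on `W` is the curvature of `W`, i.e. the component of the Lie
bracket orthogonal to `W`; this uses that the Levi-Civita connection is torsion-free. -/
theorem inner_torsion_sub_swap (hE : IsEigendistribution σ W ε)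
    (hP : ∀ Y, DiffFieldAt Y x → DiffFieldAt (reflField σ Y) x)
    (hX : DiffFieldAt X x) (hY : DiffFieldAt Y x)
    (hXW : ∀ᶠ y in 𝓝 x, X y ∈ W y) (hYW : ∀ᶠ y in 𝓝 x, Y y ∈ W y) {w : Tan n x}
    (hw : w ∈ orth W x) :
    (inner ℝ (torsion σ x (X x) (Y x) - torsion σ x (Y x) (X x)) w : ℝ) =
      inner ℝ (VectorField.mlieBracket (𝓡 n) X Y x) w := by
  have hZ := diffFieldAt_ext w
  have hw' : ext w x ∈ orth W x := by rwa [ext_self]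
  have h1 := inner_torsion_of_eventually_mem hE hP hX hY hZ hYW hw'
  have h2 := inner_torsion_of_eventually_mem hE hP hY hX hZ hXW hw'
  have h3 := koszul_sub_swap X Y (ext w) x
  rw [ext_self] at h1 h2 h3
  rw [inner_sub_left, h1, h2, h3]

/-- A distribution is integrable exactly if its torsion is symmetric on it. -/
theorem isIntegrableOn_iff (hσ : IsSmooth σ) (hE : IsEigendistribution σ W ε) {S : Set M}
    (hS : IsOpen S) (hSr : S ⊆ regularSet σ) :
    IsIntegrableOn W S ↔
      ∀ x ∈ S, ∀ u ∈ W x, ∀ v ∈ W x, torsion σ x u v = torsion σ x v u := by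
  have hP : ∀ x ∈ S, ∀ Y, DiffFieldAt Y x → DiffFieldAt (reflField σ Y) x := fun x hx Y hY =>
    hY.reflField hσ (hSr hx)
  constructor
  · intro h x hx u hu v hv
    -- A vector of `W x` is extended to a field of `W` by projecting any smooth extension of it.
    have hext : ∀ u ∈ W x, ∃ (U : Set M) (X : ∀ x : M, Tan n x), IsOpen U ∧ x ∈ U ∧
        U ⊆ S ∧ SmoothFieldOn X U ∧ (∀ y, X y ∈ W y) ∧ X x = u := by
      intro u hu
      obtain ⟨U, hU, hxU, hs⟩ := exists_smoothFieldOn_ext u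
      refine ⟨U ∩ S, fun y => (1 / 2 : ℝ) • (ext u y + ε • almostProduct σ y (ext u y)),
        hU.inter hS, ⟨hxU, hx⟩, inter_subset_right, ?_, fun y =>
        Submodule.smul_mem _ _ (hE.add_mem y _), ?_⟩
      · rw [smoothFieldOn_iff (hU.inter hS)]
        intro y hy
        have h1 := hs.smoothFieldAt hU hy.1
        have h2 : SmoothFieldAt (ε • reflField σ (ext u)) y :=
          ContMDiffAt.const_smul_section (h1.reflField hσ (hSr hy.2))
        exact ContMDiffAt.const_smul_section (ContMDiffAt.add_section h1 h2)
      · simp only [ext_self]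
        rw [hE.apply_of_mem x u hu, smul_smul, hE.mul_self]
        module
    obtain ⟨U, X, hU, hxU, hUS, hXs, hXW, rfl⟩ := hext u hu
    obtain ⟨U', Y, hU', hxU', hUS', hYs, hYW, rfl⟩ := hext v hv
    have hb := h (U ∩ U') X Y (hU.inter hU') (fun y hy => hUS hy.1)
      (hXs.mono inter_subset_left) (hYs.mono inter_subset_right) (fun y _ => hXW y)
      (fun y _ => hYW y) x ⟨hxU, hxU'⟩
    rw [← sub_eq_zero]
    have hm : torsion σ x (X x) (Y x) - torsion σ x (Y x) (X x) ∈ orth W x :=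
      Submodule.sub_mem _ (hE.torsion_mem x (hP x hx) _ hu _ hv)
        (hE.torsion_mem x (hP x hx) _ hv _ hu)
    rw [← inner_self_eq_zero (𝕜 := ℝ), inner_torsion_sub_swap hE (hP x hx)
      (hXs.smoothFieldAt hU hxU).diffFieldAt (hYs.smoothFieldAt hU' hxU').diffFieldAt
      (Eventually.of_forall hXW) (Eventually.of_forall hYW) hm]
    exact Submodule.inner_right_of_mem_orthogonal hb hm
  · intro h U X Y hU hUS hX hY hXW hYW x hx
    rw [← Submodule.orthogonal_orthogonal (W x), Submodule.mem_orthogonal']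
    intro w hw
    rw [← inner_torsion_sub_swap hE (hP x (hUS hx)) (hX.smoothFieldAt hU hx).diffFieldAt
      (hY.smoothFieldAt hU hx).diffFieldAt
      (by filter_upwards [hU.mem_nhds hx] with y hy using hXW y hy)
      (by filter_upwards [hU.mem_nhds hx] with y hy using hYW y hy) hw,
      h x (hUS hx) _ (hXW x hx) _ (hYW x hx), sub_self, inner_zero_left]

theorem IsAdaptedFrame.symm {U : Set M} {q r : ℕ} {V : Fin q → ∀ x : M, Tan n x}
    {H : Fin r → ∀ x : M, Tan n x} (h : IsAdaptedFrame σ U V H) :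
    IsAdaptedFrame (orth σ) U H V where
  isOpen := h.isOpen
  smooth_V := h.smooth_H
  smooth_H := h.smooth_V
  orthonormal_V := h.orthonormal_H
  orthonormal_H := h.orthonormal_V
  mem_V := h.mem_H
  mem_H y hy i := Submodule.le_orthogonal_orthogonal _ (h.mem_V y hy i)
  dim_V := h.dim_H
  dim_H y hy := by
    rw [← h.dim_V y hy]
    unfold dim
    rw [orth, orth, Submodule.orthogonal_orthogonal]

theorem continuousAt_inner_mlieBracket (hX : SmoothFieldAt X x) (hY : SmoothFieldAt Y x)
    (hZ : SmoothFieldAt Z x) :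
    ContinuousAt (fun y => (inner ℝ (VectorField.mlieBracket (𝓡 n) X Y y) (Z y) : ℝ)) x := by
  have hm2 : IsManifold (𝓡 n) (minSmoothness ℝ 2) M := by
    rw [minSmoothness_of_isRCLikeNormedField]
    infer_instance
  have hm3 : IsManifold (𝓡 n) (((⊤ : ℕ∞) : WithTop ℕ∞) + 1) M :=
    inferInstanceAs (IsManifold (𝓡 n) ∞ M)
  have h : SmoothFieldAt (VectorField.mlieBracket (𝓡 n) X Y) x :=
    ContMDiffAt.mlieBracket_vectorField (m := ⊤) (n := ⊤) hX hY
      (by simp [minSmoothness_of_isRCLikeNormedField])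
  exact (h.inner_field hZ).continuousAt

/-- For fields with constant mutual inner products, only brackets are left in the Koszul formula. -/
theorem continuousOn_koszul {U : Set M} (hU : IsOpen U) (hX : SmoothFieldOn X U)
    (hY : SmoothFieldOn Y U) (hZ : SmoothFieldOn Z U) {c₁ c₂ c₃ : ℝ}
    (hXY : ∀ y ∈ U, (inner ℝ (X y) (Y y) : ℝ) = c₁) (hXZ : ∀ y ∈ U, (inner ℝ (X y) (Z y) : ℝ) = c₂)
    (hYZ : ∀ y ∈ U, (inner ℝ (Y y) (Z y) : ℝ) = c₃) : ContinuousOn (koszul X Y Z) U := by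
  have hev : ∀ {Y Z : ∀ x : M, Tan n x} {c : ℝ}, (∀ y ∈ U, (inner ℝ (Y y) (Z y) : ℝ) = c) →
      ∀ y ∈ U, ∀ v : Tan n y, dMetric Y Z y v = 0 := fun {Y Z c} h y hy v =>
    dMetric_eq_zero_of_const (c := c) (by filter_upwards [hU.mem_nhds hy] with z hz using h z hz) v
  have he : ∀ y ∈ U, koszul X Y Z y = (1 / 2 : ℝ) *
      (inner ℝ (VectorField.mlieBracket (𝓡 n) X Y y) (Z y)
      - inner ℝ (VectorField.mlieBracket (𝓡 n) X Z y) (Y y)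
      - inner ℝ (VectorField.mlieBracket (𝓡 n) Y Z y) (X y)) := fun y hy => by
    rw [koszul, hev hYZ y hy, hev hXZ y hy, hev hXY y hy]
    ring
  refine ContinuousOn.congr (fun y hy => ContinuousAt.continuousWithinAt ?_) he
  have hX := hX.smoothFieldAt hU hy
  have hY := hY.smoothFieldAt hU hy
  have hZ := hZ.smoothFieldAt hU hy
  exact continuousAt_const.mul (((continuousAt_inner_mlieBracket hX hY hZ).sub
    (continuousAt_inner_mlieBracket hX hZ hY)).sub (continuousAt_inner_mlieBracket hY hZ hX))

end Integrability

/-! ### Continuity of the integrands -/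

section Continuity

variable {n : ℕ} {M : Type*} [TopologicalSpace M] [ChartedSpace (EuclideanSpace ℝ (Fin n)) M]
  [IsManifold (𝓡 n) ∞ M] [RiemannianBundle (fun x : M => TangentSpace (𝓡 n) x)]
  [IsContMDiffRiemannianBundle (𝓡 n) ∞ (EuclideanSpace ℝ (Fin n))
      (fun x : M => TangentSpace (𝓡 n) x)]
  {σ W : ∀ x : M, Submodule ℝ (Tan n x)} {x : M} {ε : ℝ}

theorem torsionNormSqOn_eq_sum (hP : ∀ Y, DiffFieldAt Y x → DiffFieldAt (reflField σ Y) x)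
    (hW : ∀ u ∈ W x, ∀ v ∈ W x, torsion σ x u v ∈ orth W x) {ι κ : Type*} [Fintype ι] [Fintype κ]
    (b : OrthonormalBasis ι ℝ (W x)) (c : OrthonormalBasis κ ℝ (orth W x)) :
    torsionNormSqOn σ W x = ∑ i, ∑ j, ∑ k,
      (inner ℝ (torsion σ x (b i : Tan n x) (b j : Tan n x)) (c k : Tan n x) : ℝ) ^ 2 := by
  have h := sum_normSq_bilin_orthonormalBasis
    ((torsionLin hP).compl₁₂ (W x).subtype (W x).subtype) (stdOrthonormalBasis ℝ (W x)) b
  refine Eq.trans h (Finset.sum_congr rfl fun i _ => Finset.sum_congr rfl fun j _ => ?_)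
  have hm := hW _ (b i).2 _ (b j).2
  simp only [sq (inner ℝ _ _ : ℝ)]
  rw [sum_inner_mul_inner_of_mem c hm hm, real_inner_self_eq_norm_sq]
  rfl

/-- The second mean curvature in arbitrary orthonormal bases. The bases in its definition are chosen
point by point and need not depend continuously on the point. -/
theorem secondMeanCurvature_eq_sum (hP : ∀ Y, DiffFieldAt Y x → DiffFieldAt (reflField σ Y) x)
    (hW : ∀ u ∈ W x, ∀ v ∈ W x, torsion σ x u v ∈ orth W x) {ι κ : Type*} [Fintype ι] [Fintype κ]
    (b : OrthonormalBasis ι ℝ (W x)) (c : OrthonormalBasis κ ℝ (orth W x)) :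
    secondMeanCurvature σ W x = (1 / 2) *
      (∑ k, (∑ i, (inner ℝ (torsion σ x (b i : Tan n x) (b i : Tan n x)) (c k : Tan n x) : ℝ)) ^ 2
      - ∑ i, ∑ j, ∑ k, (inner ℝ (torsion σ x (b i : Tan n x) (b j : Tan n x)) (c k : Tan n x) : ℝ) *
        inner ℝ (torsion σ x (b j : Tan n x) (b i : Tan n x)) (c k : Tan n x)) := by
  have hm : ∀ i j, torsion σ x (b i : Tan n x) (b j : Tan n x) ∈ orth W x := fun i j =>
    hW _ (b i).2 _ (b j).2
  have hs := Submodule.sum_mem (orth W x) (t := Finset.univ) (fun i _ => hm i i)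
  have h1 : ∑ a, torsion σ x (stdOrthonormalBasis ℝ (W x) a : Tan n x)
        (stdOrthonormalBasis ℝ (W x) a : Tan n x) =
      ∑ i, torsion σ x (b i : Tan n x) (b i : Tan n x) := sum_bilin_orthonormalBasis
    ((torsionLin hP).compl₁₂ (W x).subtype (W x).subtype) (stdOrthonormalBasis ℝ (W x)) b
  have h2 : ∑ a, ∑ b, (inner ℝ (torsion σ x (stdOrthonormalBasis ℝ (W x) a : Tan n x)
        (stdOrthonormalBasis ℝ (W x) b : Tan n x))
        (torsion σ x (stdOrthonormalBasis ℝ (W x) b : Tan n x)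
        (stdOrthonormalBasis ℝ (W x) a : Tan n x)) : ℝ) =
      ∑ i, ∑ j, (inner ℝ (torsion σ x (b i : Tan n x) (b j : Tan n x))
        (torsion σ x (b j : Tan n x) (b i : Tan n x)) : ℝ) := sum_inner_swap_bilin_orthonormalBasis
    ((torsionLin hP).compl₁₂ (W x).subtype (W x).subtype) (stdOrthonormalBasis ℝ (W x)) b
  rw [secondMeanCurvature_eq hW, h1, h2, ← real_inner_self_eq_norm_sq,
    ← sum_inner_mul_inner_of_mem c hs hs]
  congr 2
  · refine Finset.sum_congr rfl fun k _ => ?_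
    rw [sum_inner, sq]
  · refine Finset.sum_congr rfl fun i _ => Finset.sum_congr rfl fun j _ => ?_
    rw [sum_inner_mul_inner_of_mem c (hm i j) (hm j i)]

variable {U : Set M} {q r : ℕ} {V : Fin q → ∀ x : M, Tan n x} {H : Fin r → ∀ x : M, Tan n x}

theorem continuousOn_inner_torsion_frame (hE : IsEigendistribution σ W ε)
    (hP : ∀ x ∈ U, ∀ Y, DiffFieldAt Y x → DiffFieldAt (reflField σ Y) x)
    (h : IsAdaptedFrame W U V H) (i j : Fin q) (k : Fin r) :
    ContinuousOn (fun y => (inner ℝ (torsion σ y (V i y) (V j y)) (H k y) : ℝ)) U := by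
  have hVH : ∀ i, ∀ y ∈ U, (inner ℝ (V i y) (H k y) : ℝ) = 0 := fun i y hy =>
    Submodule.inner_right_of_mem_orthogonal (h.mem_V y hy i) (h.mem_H y hy k)
  have hVV : ∀ y ∈ U, (inner ℝ (V i y) (V j y) : ℝ) = if i = j then 1 else 0 := fun y hy =>
    orthonormal_iff_ite.1 (h.orthonormal_V y hy) i j
  refine (continuousOn_koszul h.isOpen (h.smooth_V i) (h.smooth_V j) (h.smooth_H k) hVV
    (hVH i) (hVH j)).congr fun y hy => ?_
  exact inner_torsion_of_eventually_mem hE (hP y hy)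
    ((h.smooth_V i).smoothFieldAt h.isOpen hy).diffFieldAt
    ((h.smooth_V j).smoothFieldAt h.isOpen hy).diffFieldAt
    ((h.smooth_H k).smoothFieldAt h.isOpen hy).diffFieldAt
    (by filter_upwards [h.isOpen.mem_nhds hy] with z hz using h.mem_V z hz j) (h.mem_H y hy k)

theorem IsAdaptedFrame.continuousOn_torsionNormSqOn (h : IsAdaptedFrame W U V H)
    (hE : IsEigendistribution σ W ε)
    (hP : ∀ x ∈ U, ∀ Y, DiffFieldAt Y x → DiffFieldAt (reflField σ Y) x) :
    ContinuousOn (torsionNormSqOn σ W) U := by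
  have hc := continuousOn_inner_torsion_frame hE hP h
  have : ContinuousOn (fun y => ∑ i, ∑ j, ∑ k,
      (inner ℝ (torsion σ y (V i y) (V j y)) (H k y) : ℝ) ^ 2) U :=
    continuousOn_finsetSum _ fun i _ => continuousOn_finsetSum _ fun j _ =>
      continuousOn_finsetSum _ fun k _ => (hc i j k).pow 2
  refine this.congr fun y hy => ?_
  obtain ⟨b, hb⟩ := h.exists_basis_V hy
  obtain ⟨c, hc⟩ := h.exists_basis_H hy
  rw [torsionNormSqOn_eq_sum (hP y hy) (hE.torsion_mem y (hP y hy)) b c]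
  simp only [hb, hc]

theorem IsAdaptedFrame.continuousOn_secondMeanCurvature (h : IsAdaptedFrame W U V H)
    (hE : IsEigendistribution σ W ε)
    (hP : ∀ x ∈ U, ∀ Y, DiffFieldAt Y x → DiffFieldAt (reflField σ Y) x) :
    ContinuousOn (secondMeanCurvature σ W) U := by
  have hc := continuousOn_inner_torsion_frame hE hP h
  have : ContinuousOn (fun y => (1 / 2) *
      (∑ k, (∑ i, (inner ℝ (torsion σ y (V i y) (V i y)) (H k y) : ℝ)) ^ 2
      - ∑ i, ∑ j, ∑ k, (inner ℝ (torsion σ y (V i y) (V j y)) (H k y) : ℝ) *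
        inner ℝ (torsion σ y (V j y) (V i y)) (H k y))) U :=
    continuousOn_const.mul ((continuousOn_finsetSum _ fun k _ =>
      (continuousOn_finsetSum _ fun i _ => hc i i k).pow 2).sub
      (continuousOn_finsetSum _ fun i _ => continuousOn_finsetSum _ fun j _ =>
      continuousOn_finsetSum _ fun k _ => (hc i j k).mul (hc j i k)))
  refine this.congr fun y hy => ?_
  obtain ⟨b, hb⟩ := h.exists_basis_V hy
  obtain ⟨c, hc⟩ := h.exists_basis_H hy
  rw [secondMeanCurvature_eq_sum (hP y hy) (hE.torsion_mem y (hP y hy)) b c]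
  simp only [hb, hc]

theorem isOpen_regularSet (σ : ∀ x : M, Submodule ℝ (Tan n x)) : IsOpen (regularSet σ) := by
  rw [isOpen_iff_mem_nhds]
  intro x hx
  filter_upwards [eventually_eventually_nhds.2 hx] with y hy
  filter_upwards [hy] with z hz
  rw [hz, hy.self_of_nhds]

theorem isOpen_stratum (σ : ∀ x : M, Submodule ℝ (Tan n x)) (q : ℕ) : IsOpen (stratum σ q) := by
  rw [isOpen_iff_mem_nhds]
  rintro x ⟨hx, rfl⟩
  filter_upwards [(isOpen_regularSet σ).mem_nhds hx, hx] with y hy hd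
  exact ⟨hy, hd⟩

theorem IsSmooth.diffFieldAt_reflField (hσ : IsSmooth σ) (hx : x ∈ regularSet σ) :
    ∀ Y, DiffFieldAt Y x → DiffFieldAt (reflField σ Y) x := fun _ hY => hY.reflField hσ hx

theorem exists_isAdaptedFrame_subset (hσ : IsSmooth σ) (hx : x ∈ regularSet σ) :
    ∃ (U : Set M) (V : Fin (dim σ x) → ∀ x : M, Tan n x)
      (H : Fin (dim (orth σ) x) → ∀ x : M, Tan n x), x ∈ U ∧ U ⊆ regularSet σ ∧
      IsAdaptedFrame σ U V H := by
  obtain ⟨U, V, H, hxU, h⟩ := exists_isAdaptedFrame hσ hx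
  refine ⟨U, V, H, hxU, fun y hy => ?_, h⟩
  filter_upwards [h.isOpen.mem_nhds hy] with z hz
  rw [h.dim_V z hz, h.dim_V y hy]

theorem continuousOn_secondMeanCurvature_self (hσ : IsSmooth σ) :
    ContinuousOn (secondMeanCurvature σ σ) (regularSet σ) := fun x hx => by
  obtain ⟨U, V, H, hxU, hU, h⟩ := exists_isAdaptedFrame_subset hσ hx
  exact ((h.continuousOn_secondMeanCurvature (isEigendistribution_self σ) fun y hy =>
    hσ.diffFieldAt_reflField (hU hy)).continuousAt (h.isOpen.mem_nhds hxU)).continuousWithinAt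

theorem continuousOn_secondMeanCurvature_orth (hσ : IsSmooth σ) :
    ContinuousOn (secondMeanCurvature σ (orth σ)) (regularSet σ) := fun x hx => by
  obtain ⟨U, V, H, hxU, hU, h⟩ := exists_isAdaptedFrame_subset hσ hx
  exact ((h.symm.continuousOn_secondMeanCurvature (isEigendistribution_orth σ) fun y hy =>
    hσ.diffFieldAt_reflField (hU hy)).continuousAt (h.isOpen.mem_nhds hxU)).continuousWithinAt

theorem continuousOn_torsionNormSq (hσ : IsSmooth σ) :
    ContinuousOn (torsionNormSq σ) (regularSet σ) := fun x hx => by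
  obtain ⟨U, V, H, hxU, hU, h⟩ := exists_isAdaptedFrame_subset hσ hx
  have hP : ∀ y ∈ U, ∀ Y, DiffFieldAt Y y → DiffFieldAt (reflField σ Y) y := fun y hy =>
    hσ.diffFieldAt_reflField (hU hy)
  have h1 := h.continuousOn_torsionNormSqOn (isEigendistribution_self σ) hP
  have h2 := h.symm.continuousOn_torsionNormSqOn (isEigendistribution_orth σ) hP
  have h3 : ContinuousOn (torsionNormSq σ) U :=
    (continuousOn_const.mul (h1.add h2)).congr fun y hy => torsionNormSq_eq (hP y hy)
  exact (h3.continuousAt (h.isOpen.mem_nhds hxU)).continuousWithinAt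

end Continuity

/-! ### Positivity of the Riemannian volume on open sets -/

section Volume

variable {n : ℕ} {M : Type*} [TopologicalSpace M] [ChartedSpace (EuclideanSpace ℝ (Fin n)) M]
  [IsManifold (𝓡 n) ∞ M] [RiemannianBundle (fun x : M => TangentSpace (𝓡 n) x)]
  [IsContMDiffRiemannianBundle (𝓡 n) ∞ (EuclideanSpace ℝ (Fin n))
      (fun x : M => TangentSpace (𝓡 n) x)]
  {e : OpenPartialHomeomorph M (EuclideanSpace ℝ (Fin n))} {y : EuclideanSpace ℝ (Fin n)}

theorem det_metricMatrix_pos (he : e ∈ atlas (EuclideanSpace ℝ (Fin n)) M) (hy : y ∈ e.target) :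
    0 < (metricMatrix e y).det := by
  have hinj : Function.Injective (mfderiv (𝓡 n) (𝓡 n) e.symm y) :=
    (mdifferentiable_of_mem_atlas (I := 𝓡 n) he).symm.mfderiv_injective hy
  have hli0 : LinearIndependent ℝ (fun i : Fin n => (EuclideanSpace.single i (1 : ℝ))) := by
    have h : (fun i : Fin n => (EuclideanSpace.single i (1 : ℝ))) =
        ⇑(EuclideanSpace.basisFun (Fin n) ℝ).toBasis := by
      funext i
      simp
    rw [h]
    exact (EuclideanSpace.basisFun (Fin n) ℝ).toBasis.linearIndependent
  have hli : LinearIndependent ℝ (fun i => coordVector e y i) :=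
    hli0.map_injOn (mfderiv (𝓡 n) (𝓡 n) e.symm y).toLinearMap hinj.injOn
  exact (Matrix.posDef_gram_of_linearIndependent (𝕜 := ℝ) hli).det_pos

theorem continuousAt_det_metricMatrix (he : e ∈ atlas (EuclideanSpace ℝ (Fin n)) M)
    (hy : y ∈ e.target) : ContinuousAt (fun y => (metricMatrix e y).det) y := by
  have hsm : ContMDiffOn (𝓡 n) (𝓡 n) ∞ e.symm e.target :=
    contMDiffOn_symm_of_mem_maximalAtlas (StructureGroupoid.subset_maximalAtlas _ he)
  have hT := hsm.contMDiffOn_tangentMapWithin (m := ∞) (by exact le_rfl)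
    e.open_target.uniqueMDiffOn
  have hcoord : ∀ i, ContMDiffAt (𝓡 n) ((𝓡 n).prod 𝓘(ℝ, EuclideanSpace ℝ (Fin n))) ∞
      (fun z => (⟨e.symm z, coordVector e z i⟩ : TangentBundle (𝓡 n) M)) y := by
    intro i
    have hs : ContMDiff (𝓡 n) ((𝓡 n).prod 𝓘(ℝ, EuclideanSpace ℝ (Fin n))) ∞
        (fun z => (⟨z, EuclideanSpace.single i (1 : ℝ)⟩ :
          TangentBundle (𝓡 n) (EuclideanSpace ℝ (Fin n)))) :=
      contMDiff_vectorSpace_iff_contDiff.2 contDiff_const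
    have hc := hT.comp (s := e.target) hs.contMDiffOn (fun z hz => hz)
    refine (hc.contMDiffAt (e.open_target.mem_nhds hy)).congr_of_eventuallyEq ?_
    filter_upwards [e.open_target.mem_nhds hy] with z hz
    simp only [Function.comp_apply, tangentMapWithin,
      mfderivWithin_of_isOpen e.open_target hz]
    rfl
  have hent : ∀ i j, ContinuousAt (fun z => metricMatrix e z i j) y := fun i j =>
    (ContMDiffAt.inner_bundle (IB := 𝓡 n) (F := EuclideanSpace ℝ (Fin n))
      (E := fun x : M => TangentSpace (𝓡 n) x) (hcoord i) (hcoord j)).continuousAt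
  have hmat : ContinuousAt (fun z => metricMatrix e z) y :=
    continuousAt_pi.2 fun i => continuousAt_pi.2 fun j => hent i j
  exact (continuous_id.matrix_det).continuousAt.comp hmat

/-- Nonempty open sets have positive Riemannian volume. -/
theorem riemVolume_ne_zero_of_isOpen [MeasurableSpace M] [BorelSpace M] {U : Set M}
    (hU : IsOpen U) (hne : U.Nonempty) : riemVolume n M U ≠ 0 := by
  obtain ⟨x, hx⟩ := hne
  set e := chartAt (EuclideanSpace ℝ (Fin n)) x with hedef
  have he : e ∈ atlas (EuclideanSpace ℝ (Fin n)) M := chart_mem_atlas _ x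
  have hxe : x ∈ e.source := mem_chart_source _ x
  have hye : e x ∈ e.target := e.map_source hxe
  have hle : chartVolume e ≤ riemVolume n M := le_iSup₂ (f := fun e _ => chartVolume e) e he
  intro h0
  have h1 : chartVolume e U = 0 := le_antisymm ((hle U).trans h0.le) bot_le
  set d : EuclideanSpace ℝ (Fin n) → ℝ≥0∞ :=
    fun y => ENNReal.ofReal (Real.sqrt (metricMatrix e y).det) with hd
  set ν := ((volume : Measure (EuclideanSpace ℝ (Fin n))).restrict e.target).withDensity d with hν
  have hmeas : AEMeasurable e.symm ν :=
    (e.continuousOn_symm.aemeasurable e.open_target.measurableSet).mono_ac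
      (withDensity_absolutelyContinuous _ _)
  have h2 : ν (e.symm ⁻¹' U) = 0 := le_antisymm ((Measure.le_map_apply hmeas U).trans h1.le) bot_le
  -- Near `e x` the density is bounded below by a positive constant.
  set c := Real.sqrt (metricMatrix e (e x)).det / 2 with hc
  have hspos : 0 < Real.sqrt (metricMatrix e (e x)).det :=
    Real.sqrt_pos.2 (det_metricMatrix_pos he hye)
  have hcpos : 0 < c := by positivity
  have hcont : ContinuousAt (fun y => Real.sqrt (metricMatrix e y).det) (e x) :=
    (continuousAt_det_metricMatrix he hye).sqrt
  have hev : ∀ᶠ y in 𝓝 (e x), c < Real.sqrt (metricMatrix e y).det :=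
    hcont.eventually (lt_mem_nhds (by rw [hc]; linarith))
  have hU' : ∀ᶠ y in 𝓝 (e x), e.symm y ∈ U := by
    have := e.continuousAt_symm hye
    refine this.eventually_mem ?_
    rw [e.left_inv hxe]
    exact hU.mem_nhds hx
  obtain ⟨O, hO, hOo, hxO⟩ := eventually_nhds_iff.1
    (hev.and (hU'.and (e.open_target.mem_nhds hye)))
  have h3 : ν O = 0 := measure_mono_null (fun y hy => (hO y hy).2.1) h2
  have hOt : O ⊆ e.target := fun y hy => (hO y hy).2.2
  rw [hν, withDensity_apply _ hOo.measurableSet, Measure.restrict_restrict hOo.measurableSet,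
    inter_eq_left.2 hOt] at h3
  have h4 : ENNReal.ofReal c * volume O ≤ ∫⁻ y in O, d y := by
    rw [← setLIntegral_const]
    exact setLIntegral_mono' hOo.measurableSet fun y hy => ENNReal.ofReal_le_ofReal (hO y hy).1.le
  rw [h3] at h4
  have h5 := (hOo.measure_pos volume ⟨_, hxO⟩).ne'
  have h6 := mul_eq_zero.1 (le_antisymm h4 bot_le)
  rcases h6 with h6 | h6
  · exact absurd (ENNReal.ofReal_eq_zero.1 h6) (not_le.2 hcpos)
  · exact h5 h6

end Volume

/-! ### Integration over the strata -/

section Final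

variable {n : ℕ} {M : Type*} [TopologicalSpace M] [ChartedSpace (EuclideanSpace ℝ (Fin n)) M]
  [IsManifold (𝓡 n) ∞ M] [RiemannianBundle (fun x : M => TangentSpace (𝓡 n) x)]
  [IsContMDiffRiemannianBundle (𝓡 n) ∞ (EuclideanSpace ℝ (Fin n))
      (fun x : M => TangentSpace (𝓡 n) x)]
  {σ W : ∀ x : M, Submodule ℝ (Tan n x)} {x : M} {q : ℕ}

theorem torsionNormSqOn_eq_zero (hW : ∀ u ∈ W x, ∀ v ∈ W x, torsion σ x u v ∈ orth W x)
    (h : dim (orth W) x = 0) : torsionNormSqOn σ W x = 0 := by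
  have hb : orth W x = ⊥ := Submodule.finrank_eq_zero.1 h
  refine Finset.sum_eq_zero fun a _ => Finset.sum_eq_zero fun b _ => ?_
  have h1 := hW _ (stdOrthonormalBasis ℝ (W x) a).2 _ (stdOrthonormalBasis ℝ (W x) b).2
  rw [hb, Submodule.mem_bot] at h1
  rw [h1, norm_zero, sq, zero_mul]

theorem secondMeanCurvature_eq_zero (h : dim (orth W) x = 0) : secondMeanCurvature σ W x = 0 := by
  have : IsEmpty (Fin (Module.finrank ℝ (orth W x))) := by
    rw [show Module.finrank ℝ (orth W x) = 0 from h]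
    infer_instance
  exact Finset.sum_of_isEmpty _

theorem lowerIntegrand_eq (hx : dim σ x = q) :
    lowerIntegrand σ q x = secondMeanCurvature σ σ x / ((dim σ x : ℝ) - 1) +
      secondMeanCurvature σ (orth σ) x / ((dim (orth σ) x : ℝ) - 1) := by
  have h : (dim (orth σ) x : ℝ) = (n : ℝ) - (q : ℝ) := by
    have h1 : ((dim σ x : ℝ) + (dim (orth σ) x : ℝ)) = n := by
      exact_mod_cast dim_add_dim_orth σ x
    rw [hx] at h1
    linarith
  rw [lowerIntegrand, h, hx]

theorem lowerIntegrand_le (hσ : IsSmooth σ) (hx : x ∈ stratum σ q) :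
    lowerIntegrand σ q x ≤ (1 / 4) * torsionNormSq σ x := by
  have hP := hσ.diffFieldAt_reflField hx.1
  rw [lowerIntegrand_eq hx.2, torsionNormSq_eq hP]
  have h1 := secondMeanCurvature_div_le (torsion_mem_orth_of_mem_self hP)
  have h2 := secondMeanCurvature_div_le (torsion_mem_orth_of_mem_orth hP)
  linarith

theorem neg_lowerIntegrand_le (hσ : IsSmooth σ) (hx : x ∈ stratum σ q) :
    -lowerIntegrand σ q x ≤ (1 / 4) * torsionNormSq σ x := by
  have hP := hσ.diffFieldAt_reflField hx.1
  rw [lowerIntegrand_eq hx.2, torsionNormSq_eq hP]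
  have h1 := neg_secondMeanCurvature_div_le (torsion_mem_orth_of_mem_self hP)
  have h2 := neg_secondMeanCurvature_div_le (torsion_mem_orth_of_mem_orth hP)
  linarith

theorem lowerIntegrand_eq_iff (hσ : IsSmooth σ) (hx : x ∈ stratum σ q) :
    lowerIntegrand σ q x = (1 / 4) * torsionNormSq σ x ↔
      secondMeanCurvature σ σ x / ((dim σ x : ℝ) - 1) = (1 / 2) * torsionNormSqOn σ σ x ∧
      secondMeanCurvature σ (orth σ) x / ((dim (orth σ) x : ℝ) - 1) =
        (1 / 2) * torsionNormSqOn σ (orth σ) x := by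
  have hP := hσ.diffFieldAt_reflField hx.1
  rw [lowerIntegrand_eq hx.2, torsionNormSq_eq hP]
  have h1 := secondMeanCurvature_div_le (torsion_mem_orth_of_mem_self hP)
  have h2 := secondMeanCurvature_div_le (torsion_mem_orth_of_mem_orth hP)
  constructor
  · intro h
    constructor <;> linarith
  · rintro ⟨h3, h4⟩
    linarith

theorem torsionNormSq_nonneg (σ : ∀ x : M, Submodule ℝ (Tan n x)) (x : M) :
    0 ≤ torsionNormSq σ x :=
  Finset.sum_nonneg fun _ _ => Finset.sum_nonneg fun _ _ => sq_nonneg _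

theorem torsionNormSq_eq_zero (hσ : IsSmooth σ) (hx : x ∈ stratum σ 0) :
    torsionNormSq σ x = 0 := by
  have hP := hσ.diffFieldAt_reflField hx.1
  have h0 : dim (orth (orth σ)) x = 0 := by
    have h1 := dim_add_dim_orth σ x
    have h2 := dim_add_dim_orth (orth σ) x
    have h3 := hx.2
    omega
  have h1 : torsionNormSqOn σ σ x = 0 := by
    have : IsEmpty (Fin (Module.finrank ℝ (σ x))) := by
      rw [show Module.finrank ℝ (σ x) = 0 from hx.2]
      infer_instance
    exact Finset.sum_of_isEmpty _
  rw [torsionNormSq_eq hP, h1, torsionNormSqOn_eq_zero (torsion_mem_orth_of_mem_orth hP) h0]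
  norm_num

/-- The equality conditions hold if and only if the integrands agree at every point. -/
theorem equalityConditions_iff (hσ : IsSmooth σ) :
    EqualityConditions σ ↔ ∀ q ∈ Finset.Icc 1 n, ∀ x ∈ stratum σ q,
      lowerIntegrand σ q x = (1 / 4) * torsionNormSq σ x := by
  refine forall_congr' fun q => forall_congr' fun hq => ?_
  rw [Finset.mem_Icc] at hq
  have hi1 := isIntegrableOn_iff hσ (isEigendistribution_self σ) (isOpen_stratum σ q)
    (fun x hx => hx.1)
  have hi2 := isIntegrableOn_iff hσ (isEigendistribution_orth σ) (isOpen_stratum σ q)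
    (fun x hx => hx.1)
  have hdim : ∀ x ∈ stratum σ q, dim σ x = q ∧ dim (orth σ) x = n - q := fun x hx => by
    have h1 := dim_add_dim_orth σ x
    have h2 : dim σ x = q := hx.2
    omega
  have hV := fun x (hx : x ∈ stratum σ q) =>
    secondMeanCurvature_div_eq_iff (hσ.diffFieldAt_reflField hx.1)
      (torsion_mem_orth_of_mem_self (hσ.diffFieldAt_reflField hx.1))
  have hH := fun x (hx : x ∈ stratum σ q) =>
    secondMeanCurvature_div_eq_iff (hσ.diffFieldAt_reflField hx.1)
      (torsion_mem_orth_of_mem_orth (hσ.diffFieldAt_reflField hx.1))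
  rw [hi1, hi2]
  constructor
  · rintro ⟨⟨hV1, hV2, hV3⟩, hH1, hH2, hH3⟩ x hx
    obtain ⟨hd1, hd2⟩ := hdim x hx
    rw [lowerIntegrand_eq_iff hσ hx]
    constructor
    -- For `q = n` nothing is required of `σ`, but the torsion has no normal components then.
    · rcases eq_or_lt_of_le hq.2 with hqn | hqn
      · have h0 : dim (orth σ) x = 0 := by omega
        rw [secondMeanCurvature_eq_zero h0, torsionNormSqOn_eq_zero
          (torsion_mem_orth_of_mem_self (hσ.diffFieldAt_reflField hx.1)) h0]
        norm_num
      -- The conditions require integrability from dimension `3` on, and umbilicity from `2` on.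
      · rw [hV x hx]
        refine ⟨fun h => hV1 (by omega) x hx, fun h => ?_, fun h => (hV3 (by omega)).2 x hx⟩
        rcases eq_or_lt_of_le h with h2 | h2
        · exact hV2 (by omega) x hx
        · exact (hV3 (by omega)).1 x hx
    · rw [hH x hx]
      refine ⟨fun h => hH1 (by omega) x hx, fun h => ?_, fun h => (hH3 (by omega)).2 x hx⟩
      rcases eq_or_lt_of_le h with h2 | h2
      · exact hH2 (by omega) x hx
      · exact (hH3 (by omega)).1 x hx
  · intro h
    have hVx := fun x hx => (hV x hx).1 ((lowerIntegrand_eq_iff hσ hx).1 (h x hx)).1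
    have hHx := fun x hx => (hH x hx).1 ((lowerIntegrand_eq_iff hσ hx).1 (h x hx)).2
    refine ⟨⟨fun h x hx => (hVx x hx).1 (by have := hdim x hx; omega),
      fun h x hx => (hVx x hx).2.1 (by have := hdim x hx; omega),
      fun h => ⟨fun x hx => (hVx x hx).2.1 (by have := hdim x hx; omega),
        fun x hx => (hVx x hx).2.2 (by have := hdim x hx; omega)⟩⟩,
      fun h x hx => (hHx x hx).1 (by have := hdim x hx; omega),
      fun h x hx => (hHx x hx).2.1 (by have := hdim x hx; omega),
      fun h => ⟨fun x hx => (hHx x hx).2.1 (by have := hdim x hx; omega),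
        fun x hx => (hHx x hx).2.2 (by have := hdim x hx; omega)⟩⟩

theorem continuousOn_lowerIntegrand (hσ : IsSmooth σ) (q : ℕ) :
    ContinuousOn (lowerIntegrand σ q) (stratum σ q) := by
  have hs : stratum σ q ⊆ regularSet σ := fun x hx => hx.1
  exact (((continuousOn_secondMeanCurvature_self hσ).mono hs).div_const _).add
    (((continuousOn_secondMeanCurvature_orth hσ).mono hs).div_const _)

section Measure

variable [MeasurableSpace M] [BorelSpace M]

theorem regularSet_eq_biUnion_stratum (σ : ∀ x : M, Submodule ℝ (Tan n x)) :
    regularSet σ = ⋃ q ∈ Finset.range (n + 1), stratum σ q := by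
  ext x
  simp only [mem_iUnion, Finset.mem_range, exists_prop]
  constructor
  · intro hx
    exact ⟨dim σ x, by have := dim_add_dim_orth σ x; omega, hx, rfl⟩
  · rintro ⟨q, -, hx⟩
    exact hx.1

/-- The total bending as a sum over the strata; the stratum of dimension `0` does not contribute,
because the torsion is zero there. -/
theorem totalBending_eq_sum (hσ : IsSmooth σ) :
    totalBending σ = ∑ q ∈ Finset.Icc 1 n,
      ∫⁻ x in stratum σ q, ENNReal.ofReal ((1 / 4) * torsionNormSq σ x) ∂(riemVolume n M) := by
  have h1 : totalBending σ =
      ∫⁻ x in regularSet σ, ENNReal.ofReal ((1 / 4) * torsionNormSq σ x) ∂(riemVolume n M) := by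
    rw [totalBending, ← lintegral_const_mul' _ _ (by norm_num)]
    refine lintegral_congr fun x => ?_
    rw [ENNReal.ofReal_mul (by norm_num), ENNReal.ofReal_div_of_pos (by norm_num)]
    norm_num
  have hd : (↑(Finset.range (n + 1)) : Set ℕ).PairwiseDisjoint (stratum σ) := by
    intro i _ j _ hij
    rw [Function.onFun, Set.disjoint_left]
    intro x hx hx'
    exact hij (hx.2.symm.trans hx'.2)
  rw [h1, regularSet_eq_biUnion_stratum, lintegral_biUnion_finset hd
    (fun q _ => (isOpen_stratum σ q).measurableSet), Finset.range_eq_Ico,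
    Finset.sum_eq_sum_Ico_succ_bot (Nat.succ_pos n)]
  have h0 : ∫⁻ x in stratum σ 0, ENNReal.ofReal ((1 / 4) * torsionNormSq σ x) ∂(riemVolume n M) =
      0 := by
    rw [setLIntegral_congr_fun (g := fun _ => 0) (isOpen_stratum σ 0).measurableSet]
    · simp
    · intro x hx
      simp [torsionNormSq_eq_zero hσ hx]
  rw [h0, zero_add]
  rfl

theorem coe_ennreal_sum {ι : Type*} (s : Finset ι) (f : ι → ℝ≥0∞) :
    ((∑ i ∈ s, f i : ℝ≥0∞) : EReal) = ∑ i ∈ s, (f i : EReal) := by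
  classical
  induction s using Finset.induction_on with
  | empty => simp
  | insert a s ha ih => rw [Finset.sum_insert ha, Finset.sum_insert ha, EReal.coe_ennreal_add, ih]

theorem coe_real_sum {ι : Type*} (s : Finset ι) (f : ι → ℝ) :
    ((∑ i ∈ s, f i : ℝ) : EReal) = ∑ i ∈ s, (f i : EReal) := by
  classical
  induction s using Finset.induction_on with
  | empty => simp
  | insert a s ha ih => rw [Finset.sum_insert ha, Finset.sum_insert ha, EReal.coe_add, ih]

/-- No integrability of `f` is needed: its negative part can only decrease the extended integral. -/
theorem extIntegral_le {α : Type*} [MeasurableSpace α] {μ : Measure α} {S : Set α}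
    (hS : MeasurableSet S) {f g : α → ℝ} (h : ∀ x ∈ S, f x ≤ g x) :
    extIntegral μ S f ≤ ((∫⁻ x in S, ENNReal.ofReal (g x) ∂μ : ℝ≥0∞) : EReal) := by
  have h1 : extIntegral μ S f ≤ ((∫⁻ x in S, ENNReal.ofReal (f x) ∂μ : ℝ≥0∞) : EReal) - 0 :=
    EReal.sub_le_sub le_rfl (EReal.coe_ennreal_nonneg _)
  rw [sub_zero] at h1
  exact h1.trans (EReal.coe_ennreal_le_coe_ennreal_iff.2
    (setLIntegral_mono' hS fun x hx => ENNReal.ofReal_le_ofReal (h x hx)))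

theorem extIntegral_eq_lintegral {α : Type*} [MeasurableSpace α] {μ : Measure α} {S : Set α}
    (hS : MeasurableSet S) {f g : α → ℝ} (h : ∀ x ∈ S, f x = g x) (h0 : ∀ x, 0 ≤ g x) :
    extIntegral μ S f = ((∫⁻ x in S, ENNReal.ofReal (g x) ∂μ : ℝ≥0∞) : EReal) := by
  have h1 : ∫⁻ x in S, ENNReal.ofReal (-f x) ∂μ = 0 := by
    rw [setLIntegral_congr_fun (g := fun _ => 0) hS]
    · simp
    · intro x hx
      simp [h x hx, h0 x]
  rw [extIntegral, h1, setLIntegral_congr_fun hS (g := fun x => ENNReal.ofReal (g x))]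
  · simp
  · intro x hx
    simp only [h x hx]

theorem extIntegral_eq_integral {α : Type*} [MeasurableSpace α] {μ : Measure α} {S : Set α}
    {f : α → ℝ} (hf : IntegrableOn f S μ) :
    extIntegral μ S f = ((∫ x in S, f x ∂μ : ℝ) : EReal) := by
  have hneg : ∫⁻ x in S, ENNReal.ofReal (-f x) ∂μ ≠ ⊤ := hf.neg.lintegral_lt_top.ne
  rw [extIntegral, integral_eq_lintegral_pos_part_sub_lintegral_neg_part hf, EReal.coe_sub,
    EReal.coe_ennreal_toReal hf.lintegral_lt_top.ne, EReal.coe_ennreal_toReal hneg]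

theorem integrableOn_torsionNormSq (hσ : IsSmooth σ) (hB : totalBending σ ≠ ⊤)
    (hq : q ∈ Finset.Icc 1 n) :
    IntegrableOn (fun x => (1 / 4) * torsionNormSq σ x) (stratum σ q) (riemVolume n M) := by
  have hc : ContinuousOn (fun x => (1 / 4) * torsionNormSq σ x) (stratum σ q) :=
    continuousOn_const.mul ((continuousOn_torsionNormSq hσ).mono fun x hx => hx.1)
  have hm := hc.aestronglyMeasurable (μ := riemVolume n M) (isOpen_stratum σ q).measurableSet
  refine (lintegral_ofReal_ne_top_iff_integrable hm
    (Eventually.of_forall fun x => mul_nonneg (by norm_num) (torsionNormSq_nonneg σ x))).1 ?_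
  rw [totalBending_eq_sum hσ] at hB
  exact (ENNReal.sum_ne_top.1 hB) q hq

theorem integrableOn_lowerIntegrand (hσ : IsSmooth σ) (hB : totalBending σ ≠ ⊤)
    (hq : q ∈ Finset.Icc 1 n) :
    IntegrableOn (lowerIntegrand σ q) (stratum σ q) (riemVolume n M) := by
  have hS := (isOpen_stratum σ q).measurableSet
  refine (integrableOn_torsionNormSq hσ hB hq).mono'
    ((continuousOn_lowerIntegrand hσ q).aestronglyMeasurable hS) ?_
  refine ae_restrict_of_forall_mem hS fun x hx => ?_
  rw [Real.norm_eq_abs, abs_le']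
  exact ⟨lowerIntegrand_le hσ hx, neg_lowerIntegrand_le hσ hx⟩

theorem lowerBound_le_totalBending (hσ : IsSmooth σ) :
    lowerBound σ ≤ (totalBending σ : EReal) := by
  rw [totalBending_eq_sum hσ, coe_ennreal_sum]
  exact Finset.sum_le_sum fun q _ =>
    extIntegral_le (isOpen_stratum σ q).measurableSet fun x hx => lowerIntegrand_le hσ hx

theorem lowerBound_eq_of_forall_eq (hσ : IsSmooth σ)
    (h : ∀ q ∈ Finset.Icc 1 n, ∀ x ∈ stratum σ q,
      lowerIntegrand σ q x = (1 / 4) * torsionNormSq σ x) :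
    lowerBound σ = (totalBending σ : EReal) := by
  rw [totalBending_eq_sum hσ, coe_ennreal_sum]
  exact Finset.sum_congr rfl fun q hq =>
    extIntegral_eq_lintegral (isOpen_stratum σ q).measurableSet (h q hq)
      fun x => mul_nonneg (by norm_num) (torsionNormSq_nonneg σ x)

/-- A nonnegative function that is continuous on an open set and has zero integral there vanishes
on the set: the volume of a nonempty open set is positive. -/
theorem eq_zero_of_setIntegral_eq_zero {S : Set M} (hS : IsOpen S) {f : M → ℝ}
    (hc : ContinuousOn f S) (h0 : ∀ x ∈ S, 0 ≤ f x) (hi : IntegrableOn f S (riemVolume n M))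
    (h : ∫ x in S, f x ∂(riemVolume n M) = 0) : ∀ x ∈ S, f x = 0 := by
  have hae := (setIntegral_eq_zero_iff_of_nonneg_ae
    (ae_restrict_of_forall_mem hS.measurableSet h0) hi).1 h
  by_contra! hne
  obtain ⟨x, hx, hfx⟩ := hne
  have hO : IsOpen (S ∩ f ⁻¹' {0}ᶜ) := hc.isOpen_inter_preimage hS isOpen_compl_singleton
  refine riemVolume_ne_zero_of_isOpen (n := n) hO ⟨x, hx, hfx⟩ ?_
  have h1 := (ae_restrict_iff' hS.measurableSet).1 hae
  refine measure_mono_null (fun y hy => ?_) (ae_iff.1 h1)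
  simp only [Set.mem_ofPred_eq, Classical.not_imp]
  exact ⟨hy.1, hy.2⟩

theorem forall_eq_of_lowerBound_eq (hσ : IsSmooth σ) (hB : totalBending σ ≠ ⊤)
    (h : lowerBound σ = (totalBending σ : EReal)) :
    ∀ q ∈ Finset.Icc 1 n, ∀ x ∈ stratum σ q,
      lowerIntegrand σ q x = (1 / 4) * torsionNormSq σ x := by
  have hg := fun q hq => integrableOn_torsionNormSq (q := q) hσ hB hq
  have hf := fun q hq => integrableOn_lowerIntegrand (q := q) hσ hB hq
  have h0 : ∀ x, 0 ≤ (1 / 4) * torsionNormSq σ x := fun x =>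
    mul_nonneg (by norm_num) (torsionNormSq_nonneg σ x)
  -- Both sides of the equality are sums of finite integrals.
  have h1 : lowerBound σ = ((∑ q ∈ Finset.Icc 1 n,
      ∫ x in stratum σ q, lowerIntegrand σ q x ∂(riemVolume n M) : ℝ) : EReal) := by
    rw [coe_real_sum]
    exact Finset.sum_congr rfl fun q hq => extIntegral_eq_integral (hf q hq)
  have h2 : (totalBending σ : EReal) = ((∑ q ∈ Finset.Icc 1 n,
      ∫ x in stratum σ q, (1 / 4) * torsionNormSq σ x ∂(riemVolume n M) : ℝ) : EReal) := by
    rw [totalBending_eq_sum hσ, coe_real_sum, coe_ennreal_sum]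
    refine Finset.sum_congr rfl fun q hq => ?_
    rw [← extIntegral_eq_integral (hg q hq)]
    exact (extIntegral_eq_lintegral (isOpen_stratum σ q).measurableSet (fun x _ => rfl) h0).symm
  rw [h1, h2, EReal.coe_eq_coe_iff, Finset.sum_eq_sum_iff_of_le fun q hq =>
    setIntegral_mono_on (hf q hq) (hg q hq) (isOpen_stratum σ q).measurableSet
      fun x hx => lowerIntegrand_le hσ hx] at h
  intro q hq x hx
  have hc : ContinuousOn (fun x => (1 / 4) * torsionNormSq σ x) (stratum σ q) :=
    continuousOn_const.mul ((continuousOn_torsionNormSq hσ).mono fun x hx => hx.1)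
  have h3 : (1 / 4) * torsionNormSq σ x - lowerIntegrand σ q x = 0 :=
    eq_zero_of_setIntegral_eq_zero (n := n) (isOpen_stratum σ q)
      (hc.sub (continuousOn_lowerIntegrand hσ q))
      (fun x hx => sub_nonneg.2 (lowerIntegrand_le hσ hx)) ((hg q hq).sub (hf q hq))
      ((integral_sub (hg q hq) (hf q hq)).trans (by rw [h q hq, sub_self])) x hx
  linarith

end Measure
end Final

end GenDist

theorem proposition3p2 (n : ℕ) (hn : 3 ≤ n)
    {M : Type*} [TopologicalSpace M] [ChartedSpace (EuclideanSpace ℝ (Fin n)) M]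
    [IsManifold (𝓡 n) ∞ M] [T2Space M] [CompactSpace M] [ConnectedSpace M]
    [MeasurableSpace M] [BorelSpace M]
    [RiemannianBundle (fun x : M => TangentSpace (𝓡 n) x)]
    [IsContMDiffRiemannianBundle (𝓡 n) ∞ (EuclideanSpace ℝ (Fin n))
      (fun x : M => TangentSpace (𝓡 n) x)]
    (σ : ∀ x : M, Submodule ℝ (TangentSpace (𝓡 n) x)) (hσ : IsSmooth σ) :
    lowerBound σ ≤ (totalBending σ : EReal) ∧
    (totalBending σ ≠ ⊤ →
      (∀ q ∈ Finset.Icc 1 n, IntegrableOn (lowerIntegrand σ q) (stratum σ q) (riemVolume n M)) ∧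
      (lowerBound σ = (totalBending σ : EReal) ↔ EqualityConditions σ)) ∧
    (EqualityConditions σ → lowerBound σ = (totalBending σ : EReal)) := by
  have heq : EqualityConditions σ → lowerBound σ = (totalBending σ : EReal) := fun h =>
    lowerBound_eq_of_forall_eq hσ ((equalityConditions_iff hσ).1 h)
  exact ⟨lowerBound_le_totalBending hσ, fun hB =>
    ⟨fun q hq => integrableOn_lowerIntegrand hσ hB hq,
      fun h => (equalityConditions_iff hσ).2 (forall_eq_of_lowerBound_eq hσ hB h), heq⟩, heq⟩
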